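/- Let $\widehat{\mathbf n}=(n_k)_{k\ge 1}$ be a sequence of integers $n_k>1$, let $N_k=n_1n_2\cdots n_k$ and $\mathbb X_m=\{0,1,\dots,m-1\}$, and let $\mathfrak S_{\widehat{\mathbf n}}=\varinjlim \mathfrak S_{N_k}$ be the inductive limit of the symmetric groups $\mathfrak S_{N_k}$ of the sets $\mathbb X_{N_k}=\mathbb X_{n_1}\times\dots\times\mathbb X_{n_k}$ along the embeddings $\sigma\mapsto\big((x_1,x_2)\mapsto(\sigma(x_1),x_2)\big)$, where $x_1\in\mathbb X_{N_j}$ and $x_2$ is the tuple of the remaining coordinates. For $\sigma\in\mathfrak S_{N_k}$ put $$\chi_{\mathrm{nat}}(\sigma)=1-\frac{\#\{x\in\mathbb X_{N_k}:\sigma x\ne x\}}{N_k};$$ this is a well-defined function on $\mathfrak S_{\widehat{\mathbf n}}$. Let $\mathbb X_{\widehat{\mathbf n}}=\prod_{k\ge1}\mathbb X_{n_k}$ with the product $\nu$ of the uniform probability measures. The group $\mathfrak S_{\widehat{\mathbf n}}$ acts on $\mathbb X_{\widehat{\mathbf n}}$ by measure preserving bijections: $\sigma\in\mathfrak S_{N_k}$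 acts on the first $k$ coordinates and fixes the others. Let $O:\mathbb X_{\widehat{\mathbf n}}\to\mathbb X_{\widehat{\mathbf n}}$ be the odometer: if $q=\min\{i:x_i<n_i-1\}$ exists, then $(Ox)_p=x_p+1 \pmod{n_p}$ for $p\le q$ and $(Ox)_p=x_p$ for $p>q$; and $O(n_1-1,n_2-1,\dots)=(0,0,\dots)$. It is a bijection, and for all $\sigma\in\mathfrak S_{\widehat{\mathbf n}}$ and $x\in\mathbb X_{\widehat{\mathbf n}}$ there is a unique integer $d(\sigma,x)$ with $\sigma(x)=O^{d(\sigma,x)}(x)$. Let $\mathcal F$ be the unitary representation of $\mathfrak S_{\widehat{\mathbf n}}$ on $\mathcal H=L^2(\mathbb X_{\widehat{\mathbf n}},\nu)\otimes\ell^2(\mathbb Z)$, regarded as the space of square integrable functions on $\mathbb X_{\widehat{\mathbf n}}\times\mathbb Z$ for the product of $\nu$ and the counting measure, given by $$(\mathcal F(\sigma)\eta)(x,m)=\eta\big(\sigma^{-1}(x),\,m-d(\sigma^{-1},x)\big),$$ and let $\xi_0=1\otimes\delta_0\in\mathcal H$. Then the von Neumann algebra $M=\mathcal F(\mathfrak S_{\widehat{\mathbf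 n}})''$ (double commutant in $\mathcal B(\mathcal H)$) is a factor of type $\mathrm{II}_1$, that is, an infinite-dimensional von Neumann algebra with center $\mathbb C1$ that has a faithful normal tracial state. Moreover, $\mathrm{tr}(A)=(A\xi_0,\xi_0)$ is a faithful normal tracial state on $M$, and $$(\mathcal F(\sigma)\xi_0,\xi_0)=\chi_{\mathrm{nat}}(\sigma)\quad\text{for all }\sigma\in\mathfrak S_{\widehat{\mathbf n}}.$$ -/

import Mathlib

open MeasureTheory

namespace OdometerRep

/-! ### The groups of permutations and their inductive limit

The sequence `n` is indexed from `0`: the entry `n k` is the `(k+1)`-st term of the sequence, and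
`[∀ k, (n k).AtLeastTwo]` says that all terms are greater than one. -/

/-- `N_k`, the product of the first `k` terms. -/
def N (n : ℕ → ℕ) (k : ℕ) : ℕ := ∏ i ∈ Finset.range k, n i

/-- The finite set `X_{N_k}`, with its identification with the product of the first `k` factors
`X_{n_i} = {0, …, n_i - 1}`. -/
abbrev Pref (n : ℕ → ℕ) (k : ℕ) : Type := (i : Fin k) → Fin (n i)

/-- The symmetric group on `X_{N_k}`. -/
abbrev SymN (n : ℕ → ℕ) (k : ℕ) : Type := Equiv.Perm (Pref n k)

/-- The first `j` coordinates of a `k`-tuple, `j ≤ k`. -/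
def res (n : ℕ → ℕ) {j k : ℕ} (h : j ≤ k) (y : Pref n k) : Pref n j :=
  fun i => y (Fin.castLE h i)

/-- `(x₁, x₂) ↦ (σ x₁, x₂)`, where `x₁` are the first `j` of `k` coordinates. -/
def embFun (n : ℕ → ℕ) {j k : ℕ} (h : j ≤ k) (σ : SymN n j) (y : Pref n k) : Pref n k :=
  fun i => if hi : (i : ℕ) < j then σ (res n h y) ⟨i, hi⟩ else y i

theorem res_embFun (n : ℕ → ℕ) {j k : ℕ} (h : j ≤ k) (σ : SymN n j) (y : Pref n k) :
    res n h (embFun n h σ y) = σ (res n h y) := by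
  funext i
  simp [res, embFun]

theorem embFun_mul (n : ℕ → ℕ) {j k : ℕ} (h : j ≤ k) (σ τ : SymN n j) (y : Pref n k) :
    embFun n h (σ * τ) y = embFun n h σ (embFun n h τ y) := by
  funext i
  by_cases hi : (i : ℕ) < j
  · have := res_embFun n h τ y
    simp only [embFun, hi, dif_pos] at this ⊢
    rw [this]; rfl
  · simp [embFun, hi]

theorem embFun_one (n : ℕ → ℕ) {j k : ℕ} (h : j ≤ k) (y : Pref n k) :
    embFun n h 1 y = y := by
  funext i
  by_cases hi : (i : ℕ) < j <;> simp [embFun, hi, res]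

/-- The diagonal embedding of the `j`-th symmetric group into the `k`-th one. -/
def emb (n : ℕ → ℕ) (j k : ℕ) (h : j ≤ k) : SymN n j →* SymN n k where
  toFun σ :=
    { toFun := embFun n h σ
      invFun := embFun n h σ⁻¹
      left_inv := fun y => by rw [← embFun_mul, inv_mul_cancel, embFun_one]
      right_inv := fun y => by rw [← embFun_mul, mul_inv_cancel, embFun_one] }
  map_one' := Equiv.ext fun y => embFun_one n h y
  map_mul' σ τ := Equiv.ext fun y => embFun_mul n h σ τ y

instance instDirectedSystem (n : ℕ → ℕ) : DirectedSystem (SymN n) (emb n · · ·) where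
  map_self k σ := by
    ext y i
    simp [emb, embFun]
    rfl
  map_map l k j hjk hkl σ := by
    ext y i
    by_cases hi : (i : ℕ) < j
    · have hk : (i : ℕ) < k := hi.trans_le hjk
      simp [emb, embFun, hi, hk]
      rfl
    · by_cases hk : (i : ℕ) < k <;> simp [emb, embFun, hi, hk, res]

/-- The inductive limit of the groups `SymN n k` along the diagonal embeddings. -/
abbrev SymLim (n : ℕ → ℕ) : Type := DirectLimit (SymN n) (emb n)

/-- The canonical map of `SymN n k` into the inductive limit. -/
def toLim (n : ℕ → ℕ) (k : ℕ) (σ : SymN n k) : SymLim n := ⟦⟨k, σ⟩⟧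

/-! ### The space of sequences and the action on it -/

/-- The product of the sets `{0, …, n_k - 1}`. -/
abbrev X (n : ℕ → ℕ) : Type := (k : ℕ) → Fin (n k)

/-- The first `k` coordinates. -/
def pre (n : ℕ → ℕ) (k : ℕ) (x : X n) : Pref n k := fun i => x i

/-- `(x, y) ↦ (σ x, y)`, where `x` are the first `k` coordinates and `y` the remaining ones. -/
def actFun (n : ℕ → ℕ) (k : ℕ) (σ : SymN n k) (x : X n) : X n :=
  fun i => if hi : i < k then σ (pre n k x) ⟨i, hi⟩ else x i

theorem pre_actFun (n : ℕ → ℕ) (k : ℕ) (σ : SymN n k) (x : X n) :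
    pre n k (actFun n k σ x) = σ (pre n k x) := by
  funext i
  simp [pre, actFun]

theorem actFun_mul (n : ℕ → ℕ) (k : ℕ) (σ τ : SymN n k) (x : X n) :
    actFun n k (σ * τ) x = actFun n k σ (actFun n k τ x) := by
  funext i
  by_cases hi : i < k
  · have := pre_actFun n k τ x
    simp only [actFun, hi, dif_pos] at this ⊢
    rw [this]; rfl
  · simp [actFun, hi]

theorem actFun_one (n : ℕ → ℕ) (k : ℕ) (x : X n) : actFun n k 1 x = x := by
  funext i
  by_cases hi : i < k <;> simp [actFun, hi, pre]

/-- The action of the `k`-th symmetric group on the space of sequences. -/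
def actN (n : ℕ → ℕ) (k : ℕ) : SymN n k →* Equiv.Perm (X n) where
  toFun σ :=
    { toFun := actFun n k σ
      invFun := actFun n k σ⁻¹
      left_inv := fun y => by rw [← actFun_mul, inv_mul_cancel, actFun_one]
      right_inv := fun y => by rw [← actFun_mul, mul_inv_cancel, actFun_one] }
  map_one' := Equiv.ext fun y => actFun_one n k y
  map_mul' σ τ := Equiv.ext fun y => actFun_mul n k σ τ y

theorem actN_emb (n : ℕ → ℕ) (j k : ℕ) (h : j ≤ k) (σ : SymN n j) :
    actN n j σ = actN n k (emb n j k h σ) := by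
  ext x i
  by_cases hi : i < j
  · have hk : i < k := hi.trans_le h
    simp [actN, actFun, emb, embFun, hi, hk]
    rfl
  · by_cases hk : i < k <;> simp [actN, actFun, emb, embFun, hi, hk, pre]

/-- The action of the inductive limit on the space of sequences. -/
def act (n : ℕ → ℕ) : SymLim n →* Equiv.Perm (X n) where
  toFun := DirectLimit.lift (emb n) (fun k σ => actN n k σ) (actN_emb n)
  map_one' := DirectLimit.lift_one (actN n) (actN_emb n)
  map_mul' g h := DirectLimit.lift_mul (actN n) (actN_emb n) g h

theorem act_toLim (n : ℕ → ℕ) (k : ℕ) (σ : SymN n k) (x : X n) :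
    act n (toLim n k σ) x = actFun n k σ x := rfl

/-- The uniform probability measure on `{0, …, n_k - 1}`. -/
noncomputable def unif (n : ℕ → ℕ) (k : ℕ) : Measure (Fin (n k)) :=
  ProbabilityTheory.uniformOn Set.univ

instance instProbUnif (n : ℕ → ℕ) [∀ k, (n k).AtLeastTwo] (k : ℕ) :
    IsProbabilityMeasure (unif n k) :=
  ProbabilityTheory.isProbabilityMeasure_uniformOn Set.finite_univ Set.univ_nonempty

/-- The product of the uniform measures. -/
noncomputable def nu (n : ℕ → ℕ) [∀ k, (n k).AtLeastTwo] : Measure (X n) :=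
  Measure.infinitePi (unif n)

instance instProbNu (n : ℕ → ℕ) [∀ k, (n k).AtLeastTwo] : IsProbabilityMeasure (nu n) := by
  unfold nu; infer_instance

theorem measurable_pre (n : ℕ → ℕ) (k : ℕ) : Measurable (pre n k) :=
  measurable_pi_lambda _ fun i => measurable_pi_apply (i : ℕ)

theorem measurable_actFun (n : ℕ → ℕ) (k : ℕ) (σ : SymN n k) : Measurable (actFun n k σ) := by
  refine measurable_pi_lambda _ fun i => ?_
  by_cases hi : i < k
  · have : (fun x => actFun n k σ x i) = (fun y : Pref n k => σ y ⟨i, hi⟩) ∘ pre n k := by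
      funext x; simp [actFun, hi]
    rw [this]
    exact (measurable_of_countable _).comp (measurable_pre n k)
  · have : (fun x => actFun n k σ x i) = fun x => x i := by
      funext x; simp [actFun, hi]
    rw [this]
    exact measurable_pi_apply i

/-- A cylinder set given by the first `k` coordinates has measure `1 / N_k`. -/
theorem map_pre_singleton (n : ℕ → ℕ) [∀ k, (n k).AtLeastTwo] (k : ℕ) (y : Pref n k) :
    (nu n).map (pre n k) {y} = ((N n k : ℕ) : ENNReal)⁻¹ := by
  rw [Measure.map_apply (measurable_pre n k) (measurableSet_singleton y)]
  have : pre n k ⁻¹' {y} = Set.pi (Finset.range k : Set ℕ)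
      (fun i => if hi : i < k then ({y ⟨i, hi⟩} : Set (Fin (n i))) else Set.univ) := by
    ext x
    simp only [Set.mem_preimage, Set.mem_singleton_iff, Set.mem_pi, Finset.coe_range, Set.mem_Iio]
    constructor
    · rintro rfl i hi
      simp [hi, pre]
    · intro h
      funext i
      have := h i i.2
      simpa [pre] using this
  rw [this, nu, Measure.infinitePi_pi _ (fun i _ => by split_ifs <;> simp)]
  have h2 : ∀ i ∈ Finset.range k, unif n i
      (if hi : i < k then ({y ⟨i, hi⟩} : Set (Fin (n i))) else Set.univ)
        = ((n i : ℕ) : ENNReal)⁻¹ := by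
    intro i hi
    rw [dif_pos (Finset.mem_range.1 hi), unif, ProbabilityTheory.uniformOn_univ]
    simp
  rw [Finset.prod_congr rfl h2, N, Nat.cast_prod, ENNReal.prod_inv_distrib]
  intro i _ j _ _
  left
  simpa using NeZero.ne (n i)

theorem map_pre_perm (n : ℕ → ℕ) [∀ k, (n k).AtLeastTwo] (k : ℕ) (σ : SymN n k) :
    ((nu n).map (pre n k)).map σ = (nu n).map (pre n k) := by
  refine Measure.ext_of_singleton fun y => ?_
  rw [Measure.map_apply (measurable_of_countable _) (measurableSet_singleton y)]
  have : σ ⁻¹' {y} = {σ.symm y} := by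
    ext z; simp [Equiv.eq_symm_apply]
  rw [this, map_pre_singleton, map_pre_singleton]

theorem measurePreserving_actN (n : ℕ → ℕ) [∀ k, (n k).AtLeastTwo] (k : ℕ) (σ : SymN n k) :
    MeasurePreserving (actN n k σ) (nu n) (nu n) := by
  refine ⟨measurable_actFun n k σ, ?_⟩
  refine Measure.eq_infinitePi _ fun s t ht => ?_
  rw [← Measure.infinitePi_pi (unif n) (fun i _ => ht i)]
  obtain ⟨j, hj⟩ : ∃ j, k ≤ j ∧ ∀ i ∈ s, i < j :=
    ⟨max k (s.sup id + 1), le_max_left _ _, fun i hi =>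
      lt_max_of_lt_right (Nat.lt_succ_of_le (Finset.le_sup (f := id) hi))⟩
  let B : Set (Pref n j) := {y | ∀ i (h : i ∈ s), y ⟨i, hj.2 i h⟩ ∈ t i}
  have hB : Set.pi (s : Set ℕ) t = pre n j ⁻¹' B := by
    ext x
    simp [B, pre, Set.mem_pi]
  have hBm : MeasurableSet B := B.toFinite.measurableSet
  change (nu n).map (actN n k σ) _ = nu n _
  have hm : Measurable (actN n j (emb n k j hj.1 σ)) := measurable_actFun n j _
  rw [hB, actN_emb n k j hj.1, Measure.map_apply hm (measurable_pre n j hBm), ← Set.preimage_comp]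
  have : pre n j ∘ actN n j (emb n k j hj.1 σ) = (emb n k j hj.1 σ) ∘ pre n j :=
    funext fun x => pre_actFun n j _ x
  have h3 := congrArg (fun m => m B) (map_pre_perm n j (emb n k j hj.1 σ))
  simp only [Measure.map_apply (measurable_of_countable (emb n k j hj.1 σ)) hBm] at h3
  rw [Measure.map_apply (measurable_pre n j) (Set.toFinite _).measurableSet] at h3
  rw [this, ← Measure.map_apply (measurable_pre n j) hBm, ← h3, Set.preimage_comp]

theorem measurePreserving_act (n : ℕ → ℕ) [∀ k, (n k).AtLeastTwo] (g : SymLim n) :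
    MeasurePreserving (act n g) (nu n) (nu n) := by
  induction g using DirectLimit.induction with
  | ih k σ => exact measurePreserving_actN n k σ

/-! ### The natural character -/

theorem card_support_emb (n : ℕ → ℕ) [∀ k, (n k).AtLeastTwo] (j k : ℕ) (h : j ≤ k)
    (σ : SymN n j) :
    ((σ.support.card : ℝ) / N n j) = ((emb n j k h σ).support.card : ℝ) / N n k := by
  have key : ∀ (l : ℕ) (τ : SymN n l),
      (nu n (pre n l ⁻¹' (τ.support : Set (Pref n l)))).toReal = (τ.support.card : ℝ) / N n l := by
    intro l τ
    rw [← Measure.map_apply (measurable_pre n l) (Set.toFinite _).measurableSet,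
      ← sum_measure_singleton, Finset.sum_congr rfl (fun y _ => map_pre_singleton n l y)]
    simp [div_eq_mul_inv]
  rw [← key, ← key]
  congr 2
  ext x
  simp only [Set.mem_preimage, Finset.mem_coe, Equiv.Perm.mem_support, ne_eq, not_iff_not]
  have hr : ∀ z : Pref n j, pre n j x = res n h (pre n k x) := fun _ => rfl
  constructor
  · intro hx
    funext i
    by_cases hi : (i : ℕ) < j
    · have := congrFun hx ⟨i, hi⟩
      simp only [emb, embFun, MonoidHom.coe_mk, OneHom.coe_mk, Equiv.coe_fn_mk, hi, dif_pos]
      exact this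
    · simp [emb, embFun, hi]
  · intro hx
    have := res_embFun n h σ (pre n k x)
    have h2 : embFun n h σ (pre n k x) = pre n k x := hx
    rw [h2] at this
    exact this.symm

/-- The natural character: `1 - #(supp σ) / N_k` for `σ` in the `k`-th symmetric group. -/
noncomputable def chiNat (n : ℕ → ℕ) [∀ k, (n k).AtLeastTwo] : SymLim n → ℝ :=
  DirectLimit.lift (emb n) (fun k σ => 1 - (σ.support.card : ℝ) / N n k)
    (fun j k h σ => by rw [card_support_emb n j k h σ])

theorem chiNat_toLim (n : ℕ → ℕ) [∀ k, (n k).AtLeastTwo] (k : ℕ) (σ : SymN n k) :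
    chiNat n (toLim n k σ) = 1 - (σ.support.card : ℝ) / N n k := rfl

/-! ### The odometer -/

open Classical in
/-- Add one with carry: with `q = min {i | x i < n i - 1}`, the coordinates `p ≤ q` become
`x p + 1 (mod n p)`, the others stay; the point all of whose coordinates are maximal is sent to
the zero sequence. -/
noncomputable def odoFun (n : ℕ → ℕ) [∀ k, (n k).AtLeastTwo] (x : X n) : X n :=
  if h : ∃ i, (x i : ℕ) < n i - 1 then
    fun p => if p ≤ Nat.find h then x p + 1 else x p
  else fun _ => 0

theorem fin_max {m : ℕ} [m.AtLeastTwo] (a : Fin m) : a + 1 = 0 ↔ ¬ ((a : ℕ) < m - 1) := by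
  have h2 : 2 ≤ m := Nat.AtLeastTwo.prop
  have ha := a.2
  rw [Fin.ext_iff, Fin.val_add, Fin.val_one', Nat.mod_eq_of_lt (by omega : 1 < m), Fin.val_zero]
  by_cases h : (a : ℕ) + 1 < m
  · rw [Nat.mod_eq_of_lt h]; omega
  · rw [show (a : ℕ) + 1 = m by omega, Nat.mod_self]; omega

open Classical in
theorem odoFun_apply (n : ℕ → ℕ) [∀ k, (n k).AtLeastTwo] (x : X n) (p : ℕ) :
    odoFun n x p = if ∀ i < p, x i + 1 = 0 then x p + 1 else x p := by
  unfold odoFun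
  split_ifs with h h1 h2
  · by_cases hp : p ≤ Nat.find h <;> simp [hp]
    rw [not_le] at hp
    exact absurd (h1 _ hp) (fun h3 => (fin_max _).1 h3 (Nat.find_spec h))
  · have hp : ¬ p ≤ Nat.find h := by
      intro hp
      exact h1 fun i hi => (fin_max _).2 (Nat.find_min h (hi.trans_le hp))
    simp [hp]
  · push Not at h
    exact ((fin_max _).2 (not_lt.2 (h p))).symm
  · push Not at h
    exact absurd (fun i _ => (fin_max _).2 (not_lt.2 (h i))) h2

open Classical in
/-- Subtract one with borrow. -/
noncomputable def odoInv (n : ℕ → ℕ) [∀ k, (n k).AtLeastTwo] (y : X n) : X n :=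
  fun p => if ∀ i < p, y i = 0 then y p - 1 else y p

theorem odoFun_zero_iff (n : ℕ → ℕ) [∀ k, (n k).AtLeastTwo] (x : X n) (p : ℕ) :
    (∀ i < p, odoFun n x i = 0) ↔ ∀ i < p, x i + 1 = 0 := by
  induction p with
  | zero => simp
  | succ p ih =>
    rw [Nat.forall_lt_succ_right, Nat.forall_lt_succ_right, ih]
    refine and_congr_right fun h => ?_
    rw [odoFun_apply, if_pos h]

theorem odoInv_max_iff (n : ℕ → ℕ) [∀ k, (n k).AtLeastTwo] (y : X n) (p : ℕ) :
    (∀ i < p, odoInv n y i + 1 = 0) ↔ ∀ i < p, y i = 0 := by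
  induction p with
  | zero => simp
  | succ p ih =>
    rw [Nat.forall_lt_succ_right, Nat.forall_lt_succ_right, ih]
    refine and_congr_right fun h => ?_
    rw [odoInv, if_pos h, sub_add_cancel]

/-- The odometer as a bijection. -/
noncomputable def odometer (n : ℕ → ℕ) [∀ k, (n k).AtLeastTwo] : Equiv.Perm (X n) where
  toFun := odoFun n
  invFun := odoInv n
  left_inv x := by
    funext p
    rw [odoInv]
    simp only [odoFun_zero_iff n x p]
    rw [odoFun_apply]
    split_ifs <;> simp
  right_inv y := by
    funext p
    rw [odoFun_apply]
    simp only [odoInv_max_iff n y p]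
    rw [odoInv]
    split_ifs <;> simp

/-! ### The cocycle -/

/-- The number with mixed radix digits `x 0, …, x (k-1)`. -/
def val (n : ℕ → ℕ) (k : ℕ) (x : X n) : ℕ := ∑ i ∈ Finset.range k, (x i : ℕ) * N n i

theorem val_succ (n : ℕ → ℕ) (k : ℕ) (x : X n) :
    val n (k + 1) x = val n k x + (x k : ℕ) * N n k := Finset.sum_range_succ _ _

theorem N_succ (n : ℕ → ℕ) (k : ℕ) : N n (k + 1) = N n k * n k := Finset.prod_range_succ _ _

theorem val_lt (n : ℕ → ℕ) (k : ℕ) (x : X n) : val n k x < N n k := by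
  induction k with
  | zero => simp [val, N]
  | succ k ih =>
    rw [val_succ, N_succ]
    have := (x k).2
    nlinarith [Nat.mul_le_mul_left (N n k) (Nat.succ_le_of_lt this)]

theorem eq_of_val_eq (n : ℕ → ℕ) (k : ℕ) (x y : X n) (h : val n k x = val n k y) :
    ∀ i < k, x i = y i := by
  induction k with
  | zero => simp
  | succ k ih =>
    rw [val_succ, val_succ] at h
    have hx := val_lt n k x
    have hy := val_lt n k y
    have hpos : 0 < N n k := by omega
    have h1 : val n k x = val n k y := by
      have := congrArg (· % N n k) h
      simpa [Nat.mod_eq_of_lt hx, Nat.mod_eq_of_lt hy] using this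
    have h2 : x k = y k := by
      rw [h1] at h
      exact Fin.ext (Nat.eq_of_mul_eq_mul_right hpos (by omega))
    intro i hi
    rcases Nat.lt_succ_iff_lt_or_eq.1 hi with h3 | rfl
    · exact ih h1 i h3
    · exact h2

theorem val_odo (n : ℕ → ℕ) [∀ k, (n k).AtLeastTwo] (k : ℕ) (x : X n) :
    ((∀ i < k, x i + 1 = 0) → val n k x + 1 = N n k ∧ val n k (odometer n x) = 0) ∧
    ((¬ ∀ i < k, x i + 1 = 0) → val n k (odometer n x) = val n k x + 1) := by
  induction k with
  | zero => simp [val, N]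
  | succ k ih =>
    have hk : odometer n x k = if ∀ i < k, x i + 1 = 0 then x k + 1 else x k := by
      have h := odoFun_apply n x k
      split_ifs at h ⊢ with h1
      · exact h
      · exact h
    have h2 : 2 ≤ n k := Nat.AtLeastTwo.prop
    have hxk := (x k).2
    rw [Nat.forall_lt_succ_right, val_succ, val_succ, N_succ]
    by_cases hc : ∀ i < k, x i + 1 = 0
    · obtain ⟨h3, h4⟩ := ih.1 hc
      rw [hk, if_pos hc, h4]
      refine ⟨fun h => ?_, fun h => ?_⟩
      · have h5 := (fin_max _).1 h.2
        have h6 : n k = (x k : ℕ) + 1 := by omega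
        refine ⟨?_, by rw [h.2]; simp⟩
        have h7 : N n k * n k = N n k * ((x k : ℕ) + 1) := congrArg (N n k * ·) h6
        rw [h7, ← h3]
        ring
      · have h5 : (x k : ℕ) < n k - 1 := by
          by_contra h6
          exact h ⟨hc, (fin_max _).2 h6⟩
        have h6 : ((x k + 1 : Fin (n k)) : ℕ) = (x k : ℕ) + 1 := by
          rw [Fin.val_add, Fin.val_one', Nat.mod_eq_of_lt (by omega : 1 < n k),
            Nat.mod_eq_of_lt (by omega)]
        rw [h6, ← h3]
        ring
    · rw [hk, if_neg hc, ih.2 hc]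
      exact ⟨fun h => absurd h.1 hc, fun _ => by ring⟩

theorem val_odo_modEq (n : ℕ → ℕ) [∀ k, (n k).AtLeastTwo] (k : ℕ) (x : X n) :
    (val n k (odometer n x) : ℤ) ≡ val n k x + 1 [ZMOD N n k] := by
  by_cases hc : ∀ i < k, x i + 1 = 0
  · obtain ⟨h1, h2⟩ := (val_odo n k x).1 hc
    rw [h2]
    have : (val n k x : ℤ) + 1 = N n k := by exact_mod_cast h1
    rw [this]
    simp [Int.ModEq]
  · rw [(val_odo n k x).2 hc]
    push_cast
    exact Int.ModEq.refl _

theorem val_odo_zpow (n : ℕ → ℕ) [∀ k, (n k).AtLeastTwo] (k : ℕ) (x : X n) (m : ℤ) :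
    (val n k ((odometer n ^ m) x) : ℤ) ≡ val n k x + m [ZMOD N n k] := by
  induction m with
  | zero => simp [Int.ModEq]
  | succ m ih =>
    rw [add_comm, zpow_add, zpow_one, Equiv.Perm.mul_apply]
    refine (val_odo_modEq n k _).trans ?_
    have := ih.add_right 1
    rwa [add_assoc, add_comm (m : ℤ) 1] at this
  | pred m ih =>
    rw [sub_eq_add_neg, add_comm, zpow_add, zpow_neg_one, Equiv.Perm.mul_apply]
    have h1 := val_odo_modEq n k ((odometer n)⁻¹ ((odometer n ^ (-(m : ℤ))) x))
    rw [← Equiv.Perm.mul_apply, mul_inv_cancel, Equiv.Perm.one_apply] at h1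
    have h2 := (h1.symm.trans ih).add_right (-1)
    have e : ∀ a b : ℤ, a + b + -1 = a + (-1 + b) := fun a b => by ring
    rw [e _ (-(m : ℤ))] at h2
    simpa using h2

theorem lt_N (n : ℕ → ℕ) [∀ k, (n k).AtLeastTwo] (k : ℕ) : k < N n k := by
  induction k with
  | zero => simp [N]
  | succ k ih =>
    have h2 : 2 ≤ n k := Nat.AtLeastTwo.prop
    rw [N_succ]
    nlinarith

/-- All nonzero powers of the odometer are free. -/
theorem odo_zpow_injective (n : ℕ → ℕ) [∀ k, (n k).AtLeastTwo] (x : X n) {a b : ℤ}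
    (h : (odometer n ^ a) x = (odometer n ^ b) x) : a = b := by
  set k := (a - b).natAbs
  have h1 := (val_odo_zpow n k x a).symm.trans (h ▸ val_odo_zpow n k x b)
  have h2 : a ≡ b [ZMOD N n k] := Int.ModEq.add_left_cancel' _ h1
  have h3 : (N n k : ℤ) ∣ a - b := h2.symm.dvd
  have h4 : a - b = 0 := Int.eq_zero_of_abs_lt_dvd h3 (by
    rw [Int.abs_eq_natAbs]
    exact_mod_cast lt_N n k)
  omega

theorem actN_eq_zpow (n : ℕ → ℕ) [∀ k, (n k).AtLeastTwo] (k : ℕ) (σ : SymN n k) (x : X n) :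
    actN n k σ x = (odometer n ^ ((val n k (actN n k σ x) : ℤ) - val n k x)) x := by
  set y := actN n k σ x with hy
  set m : ℤ := (val n k y : ℤ) - val n k x with hm
  have htail : ∀ i, k ≤ i → y i = x i := fun i hi => by
    simp [hy, actN, actFun, not_lt.2 hi]
  have hval : ∀ j, k ≤ j → (val n j y : ℤ) = val n j x + m := by
    intro j hj
    induction j, hj using Nat.le_induction with
    | base => rw [hm]; ring
    | succ j hj ih =>
      rw [val_succ, val_succ, htail j hj]
      push_cast
      rw [ih]; ring
  funext i
  refine eq_of_val_eq n (max k (i + 1)) _ _ ?_ i (lt_max_of_lt_right (Nat.lt_succ_self i))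
  have h1 := (val_odo_zpow n (max k (i + 1)) x m).symm
  rw [← hval _ (le_max_left _ _)] at h1
  have h2 := (Int.natCast_modEq_iff.1 h1)
  rw [Nat.ModEq, Nat.mod_eq_of_lt (val_lt n _ _), Nat.mod_eq_of_lt (val_lt n _ _)] at h2
  exact h2

theorem exists_zpow (n : ℕ → ℕ) [∀ k, (n k).AtLeastTwo] (g : SymLim n) (x : X n) :
    ∃ m : ℤ, act n g x = (odometer n ^ m) x := by
  induction g using DirectLimit.induction with
  | ih k σ => exact ⟨_, actN_eq_zpow n k σ x⟩

/-- The integer `d(g, x)`, unique by freeness, with `g x = O ^ d(g, x) x`. -/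
noncomputable def d (n : ℕ → ℕ) [∀ k, (n k).AtLeastTwo] (g : SymLim n) (x : X n) : ℤ :=
  (exists_zpow n g x).choose

theorem d_spec (n : ℕ → ℕ) [∀ k, (n k).AtLeastTwo] (g : SymLim n) (x : X n) :
    act n g x = (odometer n ^ d n g x) x := (exists_zpow n g x).choose_spec

theorem d_eq (n : ℕ → ℕ) [∀ k, (n k).AtLeastTwo] (g : SymLim n) (x : X n) (m : ℤ)
    (h : act n g x = (odometer n ^ m) x) : d n g x = m :=
  odo_zpow_injective n x ((d_spec n g x).symm.trans h)

theorem d_mul (n : ℕ → ℕ) [∀ k, (n k).AtLeastTwo] (g h : SymLim n) (x : X n) :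
    d n (g * h) x = d n g (act n h x) + d n h x := by
  apply d_eq
  rw [zpow_add, Equiv.Perm.mul_apply, ← d_spec, ← d_spec, map_mul, Equiv.Perm.mul_apply]

theorem d_one (n : ℕ → ℕ) [∀ k, (n k).AtLeastTwo] (x : X n) : d n 1 x = 0 := by
  apply d_eq
  simp

theorem measurable_d (n : ℕ → ℕ) [∀ k, (n k).AtLeastTwo] (g : SymLim n) : Measurable (d n g) := by
  induction g using DirectLimit.induction with
  | ih k σ =>
    have hv : Measurable (fun x : X n => (val n k x : ℤ)) := by
      have : (fun x : X n => (val n k x : ℤ)) =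
          fun x => ∑ i ∈ Finset.range k, ((x i : ℕ) : ℤ) * (N n i : ℤ) := by
        funext x; simp [val]
      rw [this]
      refine Finset.measurable_sum _ fun i _ => ?_
      exact (measurable_of_countable (fun a : Fin (n i) => ((a : ℕ) : ℤ) * (N n i : ℤ))).comp
        (measurable_pi_apply i)
    have : d n ⟦⟨k, σ⟩⟧ = fun x => (val n k (actN n k σ x) : ℤ) - val n k x :=
      funext fun x => d_eq n _ x _ (actN_eq_zpow n k σ x)
    rw [this]
    exact (hv.comp (measurable_actFun n k σ)).sub hv

/-! ### The unitary representation -/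

/-- The product of `nu n` with the counting measure on the integers. -/
noncomputable def mu (n : ℕ → ℕ) [∀ k, (n k).AtLeastTwo] : Measure (X n × ℤ) :=
  (nu n).prod Measure.count

/-- The Hilbert space `L²(X, ν) ⊗ ℓ²(ℤ)`, realized as the square integrable functions of
`(x, m)`. -/
abbrev HSp (n : ℕ → ℕ) [∀ k, (n k).AtLeastTwo] : Type := Lp ℂ 2 (mu n)

/-- `(x, m) ↦ (g x, m - d(g, x))`. -/
noncomputable def skew (n : ℕ → ℕ) [∀ k, (n k).AtLeastTwo] (g : SymLim n) (z : X n × ℤ) :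
    X n × ℤ := (act n g z.1, z.2 - d n g z.1)

theorem skew_mul (n : ℕ → ℕ) [∀ k, (n k).AtLeastTwo] (g h : SymLim n) :
    skew n (g * h) = skew n g ∘ skew n h := by
  funext z
  simp only [skew, Function.comp, d_mul, map_mul, Equiv.Perm.mul_apply]
  congr 1
  ring

theorem skew_one (n : ℕ → ℕ) [∀ k, (n k).AtLeastTwo] : skew n 1 = id := by
  funext z
  simp [skew, d_one]

theorem measurePreserving_skew (n : ℕ → ℕ) [∀ k, (n k).AtLeastTwo] (g : SymLim n) :
    MeasurePreserving (skew n g) (mu n) (mu n) := by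
  refine MeasurePreserving.skew_product (g := fun x m => m - d n g x)
    (measurePreserving_act n g) ?_ ?_
  · exact measurable_snd.sub ((measurable_d n g).comp measurable_fst)
  · exact Filter.Eventually.of_forall fun x => map_sub_right_eq_self Measure.count _

/-- `(F(g) η)(x, m) = η(g⁻¹ x, m - d(g⁻¹, x))`. -/
noncomputable def FIso (n : ℕ → ℕ) [∀ k, (n k).AtLeastTwo] (g : SymLim n) :
    HSp n →ₗᵢ[ℂ] HSp n :=
  Lp.compMeasurePreservingₗᵢ ℂ (skew n g⁻¹) (measurePreserving_skew n g⁻¹)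

theorem FIso_mul (n : ℕ → ℕ) [∀ k, (n k).AtLeastTwo] (g h : SymLim n) (η : HSp n) :
    FIso n (g * h) η = FIso n g (FIso n h η) := by
  change Lp.compMeasurePreserving _ _ η =
    Lp.compMeasurePreserving _ _ (Lp.compMeasurePreserving _ _ η)
  rw [← Lp.compMeasurePreserving_comp_apply]
  have : skew n (g * h)⁻¹ = skew n h⁻¹ ∘ skew n g⁻¹ := by rw [mul_inv_rev, skew_mul]
  congr 1
  simp only [this]

theorem FIso_one (n : ℕ → ℕ) [∀ k, (n k).AtLeastTwo] (η : HSp n) : FIso n 1 η = η := by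
  change Lp.compMeasurePreserving _ _ η = η
  simp [skew_one]

/-- The representation by isometric automorphisms. -/
noncomputable def FEquiv (n : ℕ → ℕ) [∀ k, (n k).AtLeastTwo] :
    SymLim n →* (HSp n ≃ₗᵢ[ℂ] HSp n) where
  toFun g :=
    { toLinearEquiv := LinearEquiv.ofLinearMap (FIso n g).toLinearMap (FIso n g⁻¹).toLinearMap
        (by ext1 η; simp [← FIso_mul, FIso_one]) (by ext1 η; simp [← FIso_mul, FIso_one])
      norm_map' := (FIso n g).norm_map }
  map_one' := LinearIsometryEquiv.ext fun η => FIso_one n η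
  map_mul' g h := LinearIsometryEquiv.ext fun η => FIso_mul n g h η

/-- The unitary representation `F` of the inductive limit. -/
noncomputable def F (n : ℕ → ℕ) [∀ k, (n k).AtLeastTwo] :
    SymLim n →* unitary (HSp n →L[ℂ] HSp n) :=
  (Unitary.linearIsometryEquiv (𝕜 := ℂ) (H := HSp n)).symm.toMonoidHom.comp (FEquiv n)

theorem F_apply (n : ℕ → ℕ) [∀ k, (n k).AtLeastTwo] (g : SymLim n) (η : HSp n) :
    ((F n g : HSp n →L[ℂ] HSp n) η : X n × ℤ → ℂ) =ᵐ[mu n]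
      fun z => η (act n g⁻¹ z.1, z.2 - d n g⁻¹ z.1) :=
  Lp.coeFn_compMeasurePreserving η (measurePreserving_skew n g⁻¹)

theorem mu_zero_ne_top (n : ℕ → ℕ) [∀ k, (n k).AtLeastTwo] :
    mu n (Set.univ ×ˢ {0}) ≠ ⊤ := by
  simp [mu, Measure.prod_prod]

/-- The vector `1 ⊗ δ₀`, the indicator function of `X × {0}`. -/
noncomputable def xi0 (n : ℕ → ℕ) [∀ k, (n k).AtLeastTwo] : HSp n :=
  indicatorConstLp 2 (MeasurableSet.univ.prod (measurableSet_singleton (0 : ℤ)))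
    (mu_zero_ne_top n) (1 : ℂ)

/-! ### Von Neumann algebras -/

section VN

variable {H : Type*} [NormedAddCommGroup H] [InnerProductSpace ℂ H] [CompleteSpace H]

theorem star_range_unitary {G : Type*} [Group G] (U : G →* unitary (H →L[ℂ] H)) :
    star (Set.range fun g => (U g : H →L[ℂ] H)) = Set.range fun g => (U g : H →L[ℂ] H) := by
  have key : ∀ g, star (U g : H →L[ℂ] H) = (U g⁻¹ : H →L[ℂ] H) := fun g => by
    rw [map_inv]; rfl
  ext a
  constructor
  · rintro ⟨g, hg⟩
    exact ⟨g⁻¹, by rw [← star_star a, ← hg]; exact (key g).symm⟩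
  · rintro ⟨g, rfl⟩
    exact ⟨g⁻¹, (key g).symm⟩

/-- The von Neumann algebra `U(G)''` generated by a unitary representation: the double commutant
of the set of operators `U g`. -/
noncomputable def generatedVN {G : Type*} [Group G] (U : G →* unitary (H →L[ℂ] H)) :
    VonNeumannAlgebra H where
  toStarSubalgebra :=
    (StarSubalgebra.centralizer ℂ
      (StarSubalgebra.centralizer ℂ (Set.range fun g => (U g : H →L[ℂ] H)) :
        Set (H →L[ℂ] H))).copy
      (Set.centralizer (Set.centralizer (Set.range fun g => (U g : H →L[ℂ] H))))
      (by rw [StarSubalgebra.coe_centralizer_centralizer, star_range_unitary, Set.union_self])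
  centralizer_centralizer' := Set.centralizer_centralizer_centralizer _

/-- A faithful normal tracial state on a von Neumann algebra; normality is ultraweak
continuity, written out as `τ a = ∑ ⟨a ξᵢ, ηᵢ⟩` with square summable `ξ` and `η`. -/
structure IsFaithfulNormalTrace (M : VonNeumannAlgebra H) (τ : M.toStarSubalgebra →ₗ[ℂ] ℂ) :
    Prop where
  map_one : τ 1 = 1
  nonneg : ∀ a, ∃ r : ℝ, 0 ≤ r ∧ τ (star a * a) = r
  faithful : ∀ a, τ (star a * a) = 0 → a = 0
  tracial : ∀ a b, τ (a * b) = τ (b * a)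
  normal : ∃ ξ η : ℕ → H, Summable (fun i => ‖ξ i‖ ^ 2) ∧ Summable (fun i => ‖η i‖ ^ 2) ∧
    ∀ a : M.toStarSubalgebra, HasSum (fun i => inner ℂ (η i) ((a : H →L[ℂ] H) (ξ i))) (τ a)

/-- A factor of type `II₁`: an infinite-dimensional von Neumann algebra with trivial center that
has a faithful normal tracial state. -/
structure IsII1Factor (M : VonNeumannAlgebra H) : Prop where
  center_trivial : ∀ a : H →L[ℂ] H, a ∈ M → a ∈ M.commutant → ∃ c : ℂ, a = c • 1
  infinite_dimensional : ¬ FiniteDimensional ℂ M.toStarSubalgebra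
  exists_trace : ∃ τ : M.toStarSubalgebra →ₗ[ℂ] ℂ, IsFaithfulNormalTrace M τ

/-- The functional `a ↦ ⟨a ξ, ξ⟩` on a von Neumann algebra (Mathlib's inner product is linear in
the second variable). -/
noncomputable def vectorFunctional (M : VonNeumannAlgebra H) (ξ : H) :
    M.toStarSubalgebra →ₗ[ℂ] ℂ where
  toFun a := inner ℂ ξ ((a : H →L[ℂ] H) ξ)
  map_add' a b := by simp
  map_smul' c a := by simp

end VN

end OdometerRep

namespace OdometerRep

/-! ### The odometer preserves the measure -/

/-! Read `(x, m)` as the pair `(x, y)` with `y = O ^ m x`. Since the odometer acts freely, `X × ℤ`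
is then the orbit equivalence relation, `F` moves the first point and keeps the second, and `xi0` is
the indicator function of the diagonal `m = 0`. This is the regular representation picture of the
relation.

Trace. The operators that act on the second point alone, namely multiplication by indicators of `y ∈
A` (`cutOp_comm`) and composition with `m ↦ m + j` (`compOp_comm`, `shift_comm`), lie in the
commutant. Applied to `xi0` they produce a total set (`cutOp_shift_xi0`), so `xi0` is separating for
the algebra (`eq_zero_of_apply_xi0`). Exchanging the two points preserves the measure because `O`
does; with complex conjugation it gives an antiunitary involution `J` with `a* ξ₀ = J a ξ₀`
(`star_apply_xi0`). The trace property follows from this formula. The value of the trace at `F g` is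
the measure of the fixed points of `g`, which is the natural character.

Infinite dimension. Adding one to a single digit, for different digits, gives elements that differ
at every point, so their images of `xi0` are orthonormal.

Center. If `a` is central, `v = a ξ₀` is invariant under the diagonal action `(x, y) ↦ (g x, g y)`.
Off the diagonal some `g` fix `y` and move `x` arbitrarily far along the orbit; the finite invariant
measure `|v|² dμ` then has no mass there (`setLIntegral_cylinder_eq_zero`). On the diagonal,
transitivity on cylinders of equal length makes `v` constant (`setIntegral_cylinder_eq`). Hence `v`
is a multiple of `ξ₀`, and `a` is scalar because `ξ₀` is separating. -/

theorem pre_eq_iff_val_eq (n : ℕ → ℕ) (k : ℕ) (x y : X n) :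
    pre n k x = pre n k y ↔ val n k x = val n k y := by
  refine ⟨fun h => Finset.sum_congr rfl fun i hi => ?_, fun h => ?_⟩
  · have := congrFun h ⟨i, Finset.mem_range.1 hi⟩
    simp only [pre] at this
    rw [this]
  · funext i
    exact eq_of_val_eq n k x y h i i.2

theorem pre_surjective (n : ℕ → ℕ) [∀ k, (n k).AtLeastTwo] (k : ℕ) :
    Function.Surjective (pre n k) := fun y =>
  ⟨fun i => if hi : i < k then y ⟨i, hi⟩ else 0, by funext i; simp [pre]⟩

/-- A prefix is determined by `val` modulo `N_k`, and on these residues `O ^ m` is translation by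
`m`. -/
theorem pre_zpow_eq_iff (n : ℕ → ℕ) [∀ k, (n k).AtLeastTwo] (k : ℕ) (m : ℤ) (x y : X n) :
    pre n k ((odometer n ^ m) x) = pre n k ((odometer n ^ m) y) ↔ pre n k x = pre n k y := by
  rw [pre_eq_iff_val_eq, pre_eq_iff_val_eq]
  have hx := val_odo_zpow n k x m
  have hy := val_odo_zpow n k y m
  have key : ∀ z w : X n, val n k z = val n k w ↔ (val n k z : ℤ) ≡ val n k w [ZMOD N n k] := by
    intro z w
    rw [Int.natCast_modEq_iff, Nat.ModEq, Nat.mod_eq_of_lt (val_lt n k z),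
      Nat.mod_eq_of_lt (val_lt n k w)]
  rw [key, key]
  refine ⟨fun h => ?_, fun h => ?_⟩
  · exact Int.ModEq.add_right_cancel' m ((hx.symm.trans h).trans hy)
  · exact (hx.trans (h.add_right m)).trans hy.symm

/-- The permutation of the prefixes of length `k` induced by a power of the odometer. -/
theorem exists_perm_pre_zpow (n : ℕ → ℕ) [∀ k, (n k).AtLeastTwo] (k : ℕ) (m : ℤ) :
    ∃ c : SymN n k, ∀ x, pre n k ((odometer n ^ m) x) = c (pre n k x) := by
  let s := Function.surjInv (pre_surjective n k)
  have hs : ∀ y, pre n k (s y) = y := Function.surjInv_eq (pre_surjective n k)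
  have hinj : Function.Injective fun y => pre n k ((odometer n ^ m) (s y)) := by
    intro y z h
    have := (pre_zpow_eq_iff n k m _ _).1 h
    rwa [hs, hs] at this
  refine ⟨Equiv.ofBijective _ (Finite.injective_iff_bijective.1 hinj), fun x => ?_⟩
  exact (pre_zpow_eq_iff n k m _ _).2 (hs _).symm

theorem exists_cylinder_of_mem_measurableCylinders (n : ℕ → ℕ) {s : Set (X n)}
    (hs : s ∈ measurableCylinders fun k => Fin (n k)) :
    ∃ (k : ℕ) (B : Set (Pref n k)), s = pre n k ⁻¹' B := by
  obtain ⟨I, S, -, rfl⟩ := (mem_measurableCylinders s).1 hs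
  -- The `+ 1` makes the prefix long enough to contain the largest index in `I`.
  have hI : ∀ i : I, (i : ℕ) < I.sup id + 1 := fun i =>
    Nat.lt_succ_of_le (Finset.le_sup (f := id) i.2)
  exact ⟨I.sup id + 1, {y | (fun i : I => y ⟨i, hI i⟩) ∈ S}, rfl⟩

/-- Cylinders generate the σ-algebra, and a power of the odometer permutes the prefixes of each
length, all of which have the same mass. -/
theorem measurePreserving_zpow (n : ℕ → ℕ) [∀ k, (n k).AtLeastTwo] (m : ℤ) :
    MeasurePreserving (odometer n ^ m : Equiv.Perm (X n)) (nu n) (nu n) := by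
  have hm : Measurable (odometer n ^ m : Equiv.Perm (X n)) := by
    refine measurable_pi_lambda _ fun i => ?_
    obtain ⟨c, hc⟩ := exists_perm_pre_zpow n (i + 1) m
    have : (fun x => (odometer n ^ m) x i) =
        (fun y => c y ⟨i, Nat.lt_succ_self i⟩) ∘ pre n (i + 1) := by
      funext x
      simp only [Function.comp_apply, ← hc]
      rfl
    rw [this]
    exact (measurable_of_countable _).comp (measurable_pre n _)
  refine ⟨hm, ?_⟩
  have : IsProbabilityMeasure ((nu n).map (odometer n ^ m : Equiv.Perm (X n))) :=
    Measure.isProbabilityMeasure_map hm.aemeasurable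
  refine ext_of_generate_finite _ generateFrom_measurableCylinders.symm
    isPiSystem_measurableCylinders (fun s hs => ?_) (by simp)
  obtain ⟨k, B, rfl⟩ := exists_cylinder_of_mem_measurableCylinders n hs
  obtain ⟨c, hc⟩ := exists_perm_pre_zpow n k m
  have hB : MeasurableSet B := B.toFinite.measurableSet
  have h1 : (odometer n ^ m : Equiv.Perm (X n)) ⁻¹' (pre n k ⁻¹' B) = pre n k ⁻¹' (c ⁻¹' B) := by
    ext x
    simp [hc]
  rw [Measure.map_apply hm (measurable_pre n k hB), h1,
    ← Measure.map_apply (measurable_pre n k) (Set.toFinite _).measurableSet,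
    ← Measure.map_apply (measurable_pre n k) hB,
    ← Measure.map_apply (measurable_of_countable c) hB, map_pre_perm]

/-- In the coordinates `(x, m) ↔ (x, O ^ m x)` on the orbit relation, the exchange of the two
points. -/
noncomputable def flip (n : ℕ → ℕ) [∀ k, (n k).AtLeastTwo] (z : X n × ℤ) : X n × ℤ :=
  ((odometer n ^ z.2) z.1, -z.2)

theorem flip_flip (n : ℕ → ℕ) [∀ k, (n k).AtLeastTwo] (z : X n × ℤ) : flip n (flip n z) = z := by
  simp only [flip, neg_neg, ← Equiv.Perm.mul_apply, ← zpow_add]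
  simp

theorem measurable_orbit (n : ℕ → ℕ) [∀ k, (n k).AtLeastTwo] :
    Measurable fun z : X n × ℤ => (odometer n ^ z.2) z.1 :=
  measurable_from_prod_countable_left fun m => (measurePreserving_zpow n m).measurable

theorem measurePreserving_flip (n : ℕ → ℕ) [∀ k, (n k).AtLeastTwo] :
    MeasurePreserving (flip n) (mu n) (mu n) := by
  -- With the integer as base coordinate the exchange is a skew product: negation on the base, `O ^
  -- m` on the fibre over `m`.
  have h : MeasurePreserving (fun z : ℤ × X n => (-z.1, (odometer n ^ z.1) z.2))
      (Measure.count.prod (nu n)) (Measure.count.prod (nu n)) :=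
    MeasurePreserving.skew_product (g := fun m x => (odometer n ^ m) x)
      (Measure.measurePreserving_neg Measure.count)
      ((measurable_orbit n).comp measurable_swap)
      (Filter.Eventually.of_forall fun m => (measurePreserving_zpow n m).map_eq)
  exact (Measure.measurePreserving_swap.comp h).comp Measure.measurePreserving_swap

/-- Translation of the integer coordinate. -/
def shift (n : ℕ → ℕ) (j : ℤ) (z : X n × ℤ) : X n × ℤ := (z.1, z.2 + j)

theorem measurePreserving_shift (n : ℕ → ℕ) [∀ k, (n k).AtLeastTwo] (j : ℤ) :
    MeasurePreserving (shift n j) (mu n) (mu n) :=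
  (MeasurePreserving.id (nu n)).prod (measurePreserving_add_right Measure.count j)

/-- The second point of a pair in the orbit relation does not change under `skew`. -/
theorem orbit_skew (n : ℕ → ℕ) [∀ k, (n k).AtLeastTwo] (g : SymLim n) (z : X n × ℤ) :
    (odometer n ^ (skew n g z).2) (skew n g z).1 = (odometer n ^ z.2) z.1 := by
  simp only [skew]
  rw [d_spec, ← Equiv.Perm.mul_apply, ← zpow_add]
  simp

/-! ### Operators on `L²` -/

section Operators

variable {α : Type*} [MeasurableSpace α] {μ : Measure α}

/-- Composition with a measure preserving map, as an operator on `L²`. -/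
noncomputable def compOp (f : α → α) (hf : MeasurePreserving f μ μ) : Lp ℂ 2 μ →L[ℂ] Lp ℂ 2 μ :=
  (Lp.compMeasurePreservingₗᵢ ℂ f hf).toContinuousLinearMap

theorem coeFn_compOp (f : α → α) (hf : MeasurePreserving f μ μ) (η : Lp ℂ 2 μ) :
    (compOp f hf η : α → ℂ) =ᵐ[μ] η ∘ f :=
  Lp.coeFn_compMeasurePreserving η hf

theorem compOp_compOp {f g h : α → α} (hf : MeasurePreserving f μ μ) (hg : MeasurePreserving g μ μ)
    (hh : MeasurePreserving h μ μ) (H : g ∘ f = h) (η : Lp ℂ 2 μ) :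
    compOp f hf (compOp g hg η) = compOp h hh η := by
  subst H
  exact (Lp.compMeasurePreserving_comp_apply η hg hf).symm

theorem compOp_id {f : α → α} (hf : MeasurePreserving f μ μ) (H : f = id) (η : Lp ℂ 2 μ) :
    compOp f hf η = η := by
  subst H
  exact Lp.compMeasurePreserving_id_apply η

theorem inner_compOp (f : α → α) (hf : MeasurePreserving f μ μ) (u v : Lp ℂ 2 μ) :
    inner ℂ (compOp f hf u) (compOp f hf v) = inner ℂ u v :=
  (Lp.compMeasurePreservingₗᵢ ℂ f hf).inner_map_map u v

theorem compOp_indicatorConstLp (f : α → α) (hf : MeasurePreserving f μ μ) {s t : Set α}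
    (hs : MeasurableSet s) (hμs : μ s ≠ ⊤) (ht : MeasurableSet t) (hμt : μ t ≠ ⊤)
    (H : f ⁻¹' s = t) (c : ℂ) :
    compOp f hf (indicatorConstLp 2 hs hμs c) = indicatorConstLp 2 ht hμt c := by
  subst H
  exact Lp.indicatorConstLp_compMeasurePreserving hs hμs c hf

/-- The product of an element of `L²` and the indicator function of a set. -/
noncomputable def cutFun (s : Set α) (hs : MeasurableSet s) (η : Lp ℂ 2 μ) : Lp ℂ 2 μ :=
  ((Lp.memLp η).indicator hs).toLp (s.indicator η)

theorem coeFn_cutFun (s : Set α) (hs : MeasurableSet s) (η : Lp ℂ 2 μ) :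
    (cutFun s hs η : α → ℂ) =ᵐ[μ] s.indicator η := by
  unfold cutFun
  exact MemLp.coeFn_toLp _

theorem cutFun_add (s : Set α) (hs : MeasurableSet s) (u v : Lp ℂ 2 μ) :
    cutFun s hs (u + v) = cutFun s hs u + cutFun s hs v := by
  refine Lp.ext ?_
  classical
  filter_upwards [coeFn_cutFun s hs (u + v), coeFn_cutFun s hs u, coeFn_cutFun s hs v,
    Lp.coeFn_add u v, Lp.coeFn_add (cutFun s hs u) (cutFun s hs v)] with x h1 h2 h3 h4 h5
  rw [h1, h5, Pi.add_apply, h2, h3, Set.indicator_apply, h4]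
  by_cases h : x ∈ s <;> simp [h]

theorem cutFun_smul (s : Set α) (hs : MeasurableSet s) (c : ℂ) (u : Lp ℂ 2 μ) :
    cutFun s hs (c • u) = c • cutFun s hs u := by
  refine Lp.ext ?_
  classical
  filter_upwards [coeFn_cutFun s hs (c • u), coeFn_cutFun s hs u,
    Lp.coeFn_smul c u, Lp.coeFn_smul c (cutFun s hs u)] with x h1 h2 h4 h5
  rw [h1, h5, Pi.smul_apply, h2, Set.indicator_apply, h4]
  by_cases h : x ∈ s <;> simp [h]

theorem norm_cutFun_le (s : Set α) (hs : MeasurableSet s) (u : Lp ℂ 2 μ) :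
    ‖cutFun s hs u‖ ≤ 1 * ‖u‖ := by
  rw [one_mul]
  refine Lp.norm_le_norm_of_ae_le ?_
  filter_upwards [coeFn_cutFun s hs u] with x hx
  rw [hx]
  exact norm_indicator_le_norm_self _ _

/-- Multiplication by the indicator function of a set, as an operator on `L²`. -/
noncomputable def cutOp (s : Set α) (hs : MeasurableSet s) : Lp ℂ 2 μ →L[ℂ] Lp ℂ 2 μ :=
  LinearMap.mkContinuous
    { toFun := cutFun s hs
      map_add' := cutFun_add s hs
      map_smul' := cutFun_smul s hs }
    1 (norm_cutFun_le s hs)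

theorem coeFn_cutOp (s : Set α) (hs : MeasurableSet s) (η : Lp ℂ 2 μ) :
    (cutOp s hs η : α → ℂ) =ᵐ[μ] s.indicator η :=
  coeFn_cutFun s hs η

theorem inner_cutOp_left (s : Set α) (hs : MeasurableSet s) (u v : Lp ℂ 2 μ) :
    inner ℂ (cutOp s hs u) v = inner ℂ u (cutOp s hs v) := by
  rw [L2.inner_def, L2.inner_def]
  refine integral_congr_ae ?_
  filter_upwards [coeFn_cutOp s hs u, coeFn_cutOp s hs v] with x hx hy
  rw [hx, hy]
  by_cases h : x ∈ s <;> simp [h]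

theorem cutOp_compOp (f : α → α) (hf : MeasurePreserving f μ μ) {s t : Set α}
    (hs : MeasurableSet s) (ht : MeasurableSet t) (H : f ⁻¹' s = t) (η : Lp ℂ 2 μ) :
    cutOp t ht (compOp f hf η) = compOp f hf (cutOp s hs η) := by
  subst H
  refine Lp.ext ?_
  filter_upwards [coeFn_cutOp _ ht (compOp f hf η), coeFn_compOp f hf η,
    coeFn_compOp f hf (cutOp s hs η),
    hf.quasiMeasurePreserving.ae (coeFn_cutOp s hs η)] with x h1 h2 h3 h4
  rw [h1, h3, Function.comp_apply, h4]
  by_cases h : f x ∈ s <;> simp [h, h2]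

theorem cutOp_indicatorConstLp {s t r : Set α} (hs : MeasurableSet s) (ht : MeasurableSet t)
    (hμt : μ t ≠ ⊤) (hr : MeasurableSet r) (hμr : μ r ≠ ⊤) (H : s ∩ t = r) (c : ℂ) :
    cutOp s hs (indicatorConstLp 2 ht hμt c) = indicatorConstLp 2 hr hμr c := by
  subst H
  refine Lp.ext ?_
  classical
  filter_upwards [coeFn_cutOp s hs (indicatorConstLp 2 ht hμt c),
    indicatorConstLp_coeFn (p := 2) (hs := ht) (hμs := hμt) (c := c),
    indicatorConstLp_coeFn (p := 2) (hs := hr) (hμs := hμr) (c := c)] with x h1 h2 h3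
  rw [h1, h3, Set.indicator_apply, h2]
  by_cases h : x ∈ s <;> by_cases h' : x ∈ t <;> simp [h, h']

end Operators

/-! ### Boxes -/

theorem mu_box_ne_top (n : ℕ → ℕ) [∀ k, (n k).AtLeastTwo] (A : Set (X n)) (j : ℤ) :
    mu n (A ×ˢ {j}) ≠ ⊤ := by
  simp [mu, Measure.prod_prod]

/-- The indicator function of `A × {j}`. -/
noncomputable def box (n : ℕ → ℕ) [∀ k, (n k).AtLeastTwo] (A : Set (X n)) (hA : MeasurableSet A)
    (j : ℤ) : HSp n :=
  indicatorConstLp 2 (hA.prod (measurableSet_singleton j)) (mu_box_ne_top n A j) (1 : ℂ)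

theorem inner_box (n : ℕ → ℕ) [∀ k, (n k).AtLeastTwo] (A : Set (X n)) (hA : MeasurableSet A)
    (j : ℤ) (η : HSp n) : inner ℂ (box n A hA j) η = ∫ z in A ×ˢ {j}, η z ∂mu n :=
  L2.inner_indicatorConstLp_one _ _ η

theorem eq_zero_of_inner_box (n : ℕ → ℕ) [∀ k, (n k).AtLeastTwo] (η : HSp n)
    (h : ∀ A hA j, inner ℂ (box n A hA j) η = 0) : η = 0 := by
  have hint : ∀ s, mu n s < ⊤ → IntegrableOn η s (mu n) := fun s hs => by
    have : IsFiniteMeasure ((mu n).restrict s) := ⟨by simpa using hs⟩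
    exact ((Lp.memLp η).restrict s).integrable (by norm_num)
  refine (Lp.eq_zero_iff_ae_eq_zero).2 (Lp.ae_eq_zero_of_forall_setIntegral_eq_zero η (by simp)
    (by simp) (fun s _ hs => hint s hs) fun s hs hμs => ?_)
  -- Any measurable set is the disjoint union of its slices at the integers, and each slice is a
  -- box.
  let A : ℤ → Set (X n) := fun j => (fun x => (x, j)) ⁻¹' s
  have hA : ∀ j, MeasurableSet (A j) := fun j => measurable_prodMk_right hs
  have hs' : s = ⋃ j, A j ×ˢ {j} := by
    ext ⟨x, m⟩
    simp [A]
  rw [hs', integral_iUnion (fun j => (hA j).prod (measurableSet_singleton j)) ?_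
    (hs' ▸ hint s hμs)]
  · simp [← inner_box n _ (hA _), h]
  · intro i j hij
    exact Set.disjoint_left.2 fun z hz hz' => hij (hz.2.symm.trans hz'.2)

theorem xi0_eq_box (n : ℕ → ℕ) [∀ k, (n k).AtLeastTwo] :
    xi0 n = box n Set.univ MeasurableSet.univ 0 := rfl

theorem norm_xi0 (n : ℕ → ℕ) [∀ k, (n k).AtLeastTwo] : ‖xi0 n‖ = 1 := by
  rw [xi0, norm_indicatorConstLp (by simp) (by simp)]
  simp [Measure.real, mu, Measure.prod_prod]

/-! ### Operators in the commutant -/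

theorem F_eq_compOp (n : ℕ → ℕ) [∀ k, (n k).AtLeastTwo] (g : SymLim n) :
    (F n g : HSp n →L[ℂ] HSp n) = compOp (skew n g⁻¹) (measurePreserving_skew n g⁻¹) := rfl

theorem mem_generatedVN {H : Type*} [NormedAddCommGroup H] [InnerProductSpace ℂ H]
    [CompleteSpace H] {G : Type*} [Group G] {U : G →* unitary (H →L[ℂ] H)} {a : H →L[ℂ] H} :
    a ∈ generatedVN U ↔
      ∀ b : H →L[ℂ] H, (∀ g, (U g : H →L[ℂ] H) * b = b * U g) → b * a = a * b := by
  change a ∈ Set.centralizer (Set.centralizer (Set.range fun g => (U g : H →L[ℂ] H))) ↔ _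
  simp [Set.mem_centralizer_iff]

theorem apply_mem_generatedVN {H : Type*} [NormedAddCommGroup H] [InnerProductSpace ℂ H]
    [CompleteSpace H] {G : Type*} [Group G] (U : G →* unitary (H →L[ℂ] H)) (g : G) :
    (U g : H →L[ℂ] H) ∈ generatedVN U :=
  mem_generatedVN.2 fun _ hb => (hb g).symm

/-- A map that commutes with the action on the first point induces an operator of the commutant,
with which every element of the double commutant commutes. -/
theorem compOp_comm (n : ℕ → ℕ) [∀ k, (n k).AtLeastTwo] {a : HSp n →L[ℂ] HSp n}
    (ha : a ∈ generatedVN (F n)) (f : X n × ℤ → X n × ℤ) (hf : MeasurePreserving f (mu n) (mu n))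
    (H : ∀ g, f ∘ skew n g = skew n g ∘ f) (η : HSp n) :
    compOp f hf (a η) = a (compOp f hf η) := by
  refine DFunLike.congr_fun (mem_generatedVN.1 ha (compOp f hf) fun g => ?_) η
  ext1 ζ
  simp only [F_eq_compOp, mul_apply_eq_comp]
  rw [compOp_compOp _ _ ((measurePreserving_skew n g⁻¹).comp hf) (H _),
    compOp_compOp _ _ ((measurePreserving_skew n g⁻¹).comp hf) rfl]

theorem cutOp_comm (n : ℕ → ℕ) [∀ k, (n k).AtLeastTwo] {a : HSp n →L[ℂ] HSp n}
    (ha : a ∈ generatedVN (F n)) {s : Set (X n × ℤ)} (hs : MeasurableSet s)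
    (H : ∀ g, skew n g ⁻¹' s = s) (η : HSp n) :
    cutOp s hs (a η) = a (cutOp s hs η) := by
  refine DFunLike.congr_fun (mem_generatedVN.1 ha (cutOp s hs) fun g => ?_) η
  ext1 ζ
  simp only [F_eq_compOp, mul_apply_eq_comp]
  rw [cutOp_compOp _ _ hs hs (H _)]

theorem measurableSet_orbit_preimage (n : ℕ → ℕ) [∀ k, (n k).AtLeastTwo] {A : Set (X n)}
    (hA : MeasurableSet A) : MeasurableSet {z : X n × ℤ | (odometer n ^ z.2) z.1 ∈ A} :=
  measurable_orbit n hA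

theorem shift_comm (n : ℕ → ℕ) [∀ k, (n k).AtLeastTwo] (j : ℤ) (g : SymLim n) :
    shift n j ∘ skew n g = skew n g ∘ shift n j := by
  funext z
  simp only [shift, skew, Function.comp_apply]
  congr 1
  ring

theorem skew_preimage_orbit (n : ℕ → ℕ) [∀ k, (n k).AtLeastTwo] (A : Set (X n)) (g : SymLim n) :
    skew n g ⁻¹' {z : X n × ℤ | (odometer n ^ z.2) z.1 ∈ A} =
      {z : X n × ℤ | (odometer n ^ z.2) z.1 ∈ A} := by
  ext z
  simp only [Set.mem_preimage, Set.mem_ofPred_eq, orbit_skew]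

/-- The exchange of the two points of a pair in the orbit relation, as an operator. -/
noncomputable def flipOp (n : ℕ → ℕ) [∀ k, (n k).AtLeastTwo] : HSp n →L[ℂ] HSp n :=
  compOp (flip n) (measurePreserving_flip n)

theorem flipOp_flipOp (n : ℕ → ℕ) [∀ k, (n k).AtLeastTwo] (η : HSp n) :
    flipOp n (flipOp n η) = η := by
  have h : flip n ∘ flip n = id := funext (flip_flip n)
  rw [flipOp, compOp_compOp _ _ (MeasurePreserving.id (mu n)) h, compOp_id _ rfl]

/-- Operators of the commutant carry `xi0` to all flipped boxes, so `xi0` is cyclic for the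
commutant. -/
theorem cutOp_shift_xi0 (n : ℕ → ℕ) [∀ k, (n k).AtLeastTwo] (A : Set (X n))
    (hA : MeasurableSet A) (j : ℤ) :
    cutOp _ (measurableSet_orbit_preimage n hA)
      (compOp (shift n j) (measurePreserving_shift n j) (xi0 n)) = flipOp n (box n A hA j) := by
  have h1 : shift n j ⁻¹' (Set.univ ×ˢ {0}) = Set.univ ×ˢ {-j} := by
    ext z
    simp [shift, eq_neg_iff_add_eq_zero]
  have hm := (hA.prod (measurableSet_singleton j)).preimage (measurePreserving_flip n).measurable
  have ht : mu n (flip n ⁻¹' (A ×ˢ {j})) ≠ ⊤ := by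
    rw [(measurePreserving_flip n).measure_preimage
      (hA.prod (measurableSet_singleton j)).nullMeasurableSet]
    exact mu_box_ne_top n A j
  rw [xi0_eq_box, box, compOp_indicatorConstLp _ _ _ _ (MeasurableSet.univ.prod (measurableSet_singleton (-j)))
    (mu_box_ne_top n _ _) h1, cutOp_indicatorConstLp _ _ _ hm ht, flipOp, box,
    compOp_indicatorConstLp _ _ _ _ hm ht rfl]
  ext z
  simp [flip, neg_eq_iff_eq_neg]

/-- On the support of `xi0` the two points of a pair coincide, so a condition on the second point is
one on the first. -/
theorem shift_cutOp_xi0 (n : ℕ → ℕ) [∀ k, (n k).AtLeastTwo] (A : Set (X n))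
    (hA : MeasurableSet A) (j : ℤ) :
    compOp (shift n (-j)) (measurePreserving_shift n (-j))
      (cutOp _ (measurableSet_orbit_preimage n hA) (xi0 n)) = box n A hA j := by
  have hm := hA.prod (measurableSet_singleton (0 : ℤ))
  rw [xi0_eq_box, box, cutOp_indicatorConstLp _ _ _ hm (mu_box_ne_top n _ _), box,
    compOp_indicatorConstLp]
  · ext z
    simp [shift, add_neg_eq_zero]
  · ext z
    simp only [Set.mem_inter_iff, Set.mem_ofPred_eq, Set.mem_prod, Set.mem_singleton_iff,
      Set.mem_univ, true_and]
    refine and_congr_left fun h => ?_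
    rw [h]
    simp

/-! ### The trace -/

/-- Elements of the algebra are determined by their value at `xi0`. -/
theorem eq_zero_of_apply_xi0 (n : ℕ → ℕ) [∀ k, (n k).AtLeastTwo] {a : HSp n →L[ℂ] HSp n}
    (ha : a ∈ generatedVN (F n)) (h : a (xi0 n) = 0) : a = 0 := by
  have h1 : ∀ A hA j, a (flipOp n (box n A hA j)) = 0 := by
    intro A hA j
    rw [← cutOp_shift_xi0, ← cutOp_comm n ha _ (skew_preimage_orbit n A),
      ← compOp_comm n ha _ _ (shift_comm n j), h, map_zero, map_zero]
  -- Passing to the adjoint replaces density of the span of the boxes by the fact that only zero is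
  -- orthogonal to all boxes.
  have h2 : ∀ ζ, (star (a * flipOp n)) ζ = 0 := by
    intro ζ
    refine eq_zero_of_inner_box n _ fun A hA j => ?_
    rw [ContinuousLinearMap.star_eq_adjoint, ContinuousLinearMap.adjoint_inner_right,
      mul_apply_eq_comp, h1, inner_zero_left]
  have h3 : a * flipOp n = 0 := by
    rw [← star_star (a * flipOp n), show star (a * flipOp n) = 0 from ContinuousLinearMap.ext h2,
      star_zero]
  ext1 ζ
  have := DFunLike.congr_fun h3 (flipOp n ζ)
  rwa [mul_apply_eq_comp, flipOp_flipOp] at this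

/-- This identifies the modular conjugation `J η = star (flipOp n η)`. Both sides are tested against
boxes: the same shift and cut that make a flipped box out of `xi0` can be moved across `a`, and on
the other side they make the box itself. -/
theorem star_apply_xi0 (n : ℕ → ℕ) [∀ k, (n k).AtLeastTwo] {a : HSp n →L[ℂ] HSp n}
    (ha : a ∈ generatedVN (F n)) : star a (xi0 n) = star (flipOp n (a (xi0 n))) := by
  rw [← sub_eq_zero]
  refine eq_zero_of_inner_box n _ fun A hA j => ?_
  have hinv : ∀ η, compOp (shift n (-j)) (measurePreserving_shift n (-j))
      (compOp (shift n j) (measurePreserving_shift n j) η) = η := fun η => by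
    rw [compOp_compOp _ _ (MeasurePreserving.id (mu n)) (funext fun z => by simp [shift]),
      compOp_id _ rfl]
  have h1 : inner ℂ (box n A hA j) (star a (xi0 n)) =
      inner ℂ (a (xi0 n)) (flipOp n (box n A hA j)) := by
    rw [ContinuousLinearMap.star_eq_adjoint, ContinuousLinearMap.adjoint_inner_right,
      ← cutOp_shift_xi0, ← inner_cutOp_left, cutOp_comm n ha _ (skew_preimage_orbit n A),
      ← inner_compOp (shift n (-j)) (measurePreserving_shift n (-j))
        (a (cutOp _ _ (xi0 n))), hinv,
      compOp_comm n ha _ _ (shift_comm n (-j)), shift_cutOp_xi0]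
  have h2 : inner ℂ (a (xi0 n)) (flipOp n (box n A hA j)) =
      inner ℂ (flipOp n (a (xi0 n))) (box n A hA j) := by
    rw [← inner_compOp (flip n) (measurePreserving_flip n)]
    congr 1
    exact flipOp_flipOp n _
  rw [inner_sub_right, h1, h2, ← inner_conj_symm, inner_box, inner_box, ← integral_conj, sub_eq_zero]
  refine setIntegral_congr_ae (hA.prod (measurableSet_singleton j)) ?_
  filter_upwards [Lp.coeFn_star (flipOp n (a (xi0 n)))] with z hz _
  rw [hz]
  rfl

theorem inner_star_star {α : Type*} [MeasurableSpace α] {μ : Measure α} (u v : Lp ℂ 2 μ) :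
    inner ℂ (star u) (star v) = inner ℂ v u := by
  rw [L2.inner_def, L2.inner_def]
  refine integral_congr_ae ?_
  filter_upwards [Lp.coeFn_star u, Lp.coeFn_star v] with z h1 h2
  rw [h1, h2]
  simp [mul_comm]

theorem compOp_star {α : Type*} [MeasurableSpace α] {μ : Measure α} (f : α → α)
    (hf : MeasurePreserving f μ μ) (η : Lp ℂ 2 μ) : compOp f hf (star η) = star (compOp f hf η) := by
  refine Lp.ext ?_
  filter_upwards [coeFn_compOp f hf (star η), Lp.coeFn_star (compOp f hf η), coeFn_compOp f hf η,
    hf.quasiMeasurePreserving.ae (Lp.coeFn_star η)] with z h1 h2 h3 h4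
  rw [h1, h2, Function.comp_apply, h4, Pi.star_apply, Pi.star_apply, h3, Function.comp_apply]

/-- With `J` as above, `⟨ξ₀, a b ξ₀⟩ = ⟨J a ξ₀, b ξ₀⟩`, and this is symmetric in `a` and `b` because
`J` is an antiunitary involution. -/
theorem inner_mul_comm (n : ℕ → ℕ) [∀ k, (n k).AtLeastTwo] {a b : HSp n →L[ℂ] HSp n}
    (ha : a ∈ generatedVN (F n)) (hb : b ∈ generatedVN (F n)) :
    inner ℂ (xi0 n) (a (b (xi0 n))) = inner ℂ (xi0 n) (b (a (xi0 n))) := by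
  have key : ∀ (c : HSp n →L[ℂ] HSp n), c ∈ generatedVN (F n) → ∀ η,
      inner ℂ (xi0 n) (c η) = inner ℂ (star (flipOp n (c (xi0 n)))) η := fun c hc η => by
    rw [← star_apply_xi0 n hc, ContinuousLinearMap.star_eq_adjoint,
      ContinuousLinearMap.adjoint_inner_left]
  rw [key a ha, key b hb, ← inner_star_star, star_star,
    ← inner_compOp (flip n) (measurePreserving_flip n), compOp_star]
  congr 1
  exact flipOp_flipOp n _

theorem isFaithfulNormalTrace_vectorFunctional (n : ℕ → ℕ) [∀ k, (n k).AtLeastTwo] :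
    IsFaithfulNormalTrace (generatedVN (F n)) (vectorFunctional (generatedVN (F n)) (xi0 n)) where
  map_one := by
    simp [vectorFunctional, norm_xi0]
  nonneg a := ⟨‖(a : HSp n →L[ℂ] HSp n) (xi0 n)‖ ^ 2, by positivity, by
    simp [vectorFunctional, ContinuousLinearMap.star_eq_adjoint,
      ContinuousLinearMap.adjoint_inner_right]⟩
  faithful a h := by
    refine Subtype.ext (eq_zero_of_apply_xi0 n a.2 ?_)
    simpa [vectorFunctional, ContinuousLinearMap.star_eq_adjoint,
      ContinuousLinearMap.adjoint_inner_right] using h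
  tracial a b := inner_mul_comm n a.2 b.2
  normal := by
    -- A vector functional is the ultraweakly continuous form with a single nonzero term, placed at
    -- index `0`.
    have hs : Summable fun i : ℕ => ‖(if i = 0 then xi0 n else 0 : HSp n)‖ ^ 2 :=
      summable_of_ne_finset_zero (s := {0}) fun i hi => by
        simp [Finset.mem_singleton.not.1 hi]
    refine ⟨fun i => if i = 0 then xi0 n else 0, fun i => if i = 0 then xi0 n else 0, hs, hs,
      fun a => ?_⟩
    convert hasSum_ite_eq (0 : ℕ) (vectorFunctional (generatedVN (F n)) (xi0 n) a) using 2 with i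
    by_cases h : i = 0 <;> simp [h, vectorFunctional]

/-! ### The character -/

theorem d_eq_zero_iff (n : ℕ → ℕ) [∀ k, (n k).AtLeastTwo] (g : SymLim n) (x : X n) :
    d n g x = 0 ↔ act n g x = x :=
  ⟨fun h => by rw [d_spec, h]; simp, fun h => d_eq n g x 0 (by simpa using h)⟩

/-- The diagonal and its image under `g` overlap exactly where the cocycle of `g⁻¹` vanishes, that
is, over the fixed points of `g`. -/
theorem inner_xi0_F (n : ℕ → ℕ) [∀ k, (n k).AtLeastTwo] (g : SymLim n) :
    inner ℂ (xi0 n) ((F n g : HSp n →L[ℂ] HSp n) (xi0 n)) =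
      ((nu n).real {x | act n g x = x} : ℂ) := by
  have hm : MeasurableSet (skew n g⁻¹ ⁻¹' (Set.univ ×ˢ {0})) :=
    (measurePreserving_skew n g⁻¹).measurable
      (MeasurableSet.univ.prod (measurableSet_singleton (0 : ℤ)))
  have ht : mu n (skew n g⁻¹ ⁻¹' (Set.univ ×ˢ {0})) ≠ ⊤ := by
    rw [(measurePreserving_skew n g⁻¹).measure_preimage
      (MeasurableSet.univ.prod (measurableSet_singleton (0 : ℤ))).nullMeasurableSet]
    exact mu_zero_ne_top n
  rw [F_eq_compOp, xi0, compOp_indicatorConstLp _ _ _ _ hm ht rfl,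
    L2.inner_indicatorConstLp_one_indicatorConstLp_one _ hm (mu_zero_ne_top n) ht]
  have h : (Set.univ ×ˢ {0} : Set (X n × ℤ)) ∩ skew n g⁻¹ ⁻¹' (Set.univ ×ˢ {0}) =
      {x | d n g⁻¹ x = 0} ×ˢ {0} := by
    ext z
    simp only [Set.mem_inter_iff, Set.mem_prod, Set.mem_univ, Set.mem_singleton_iff, true_and,
      Set.mem_preimage, skew, Set.mem_ofPred_eq]
    constructor
    · rintro ⟨h1, h2⟩
      exact ⟨by omega, h1⟩
    · rintro ⟨h1, h2⟩
      exact ⟨h2, by omega⟩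
  have h2 : {x | d n g⁻¹ x = 0} = {x | act n g x = x} := by
    ext x
    simp only [Set.mem_ofPred_eq, d_eq_zero_iff, map_inv, Equiv.Perm.inv_eq_iff_eq]
    exact eq_comm
  rw [h, Measure.real, mu, Measure.prod_prod, h2]
  simp [Measure.real]

theorem nu_real_fixed (n : ℕ → ℕ) [∀ k, (n k).AtLeastTwo] (g : SymLim n) :
    (nu n).real {x | act n g x = x} = chiNat n g := by
  induction g using DirectLimit.induction with
  | ih k σ =>
    change _ = 1 - (σ.support.card : ℝ) / N n k
    have h : {x | act n (toLim n k σ) x = x} = (pre n k ⁻¹' (σ.support : Set (Pref n k)))ᶜ := by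
      ext x
      simp only [Set.mem_ofPred_eq, Set.mem_compl_iff, Set.mem_preimage, Finset.mem_coe,
        Equiv.Perm.mem_support, not_not, act_toLim]
      constructor
      · intro hx
        rw [← pre_actFun, hx]
      · intro hx
        funext i
        by_cases hi : i < k <;> simp [actFun, hi, hx, pre]
    change (nu n).real {x | act n (toLim n k σ) x = x} = _
    rw [h, probReal_compl_eq_one_sub (measurable_pre n k (Set.toFinite _).measurableSet),
      Measure.real, ← Measure.map_apply (measurable_pre n k) (Set.toFinite _).measurableSet,
      ← sum_measure_singleton, Finset.sum_congr rfl (fun y _ => map_pre_singleton n k y)]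
    simp [div_eq_mul_inv]

/-! ### Shifting a digit on a cylinder -/

/-- Add one to the last digit of those sequences whose first `k` digits are `w`. -/
noncomputable def digitFun (n : ℕ → ℕ) {k l : ℕ} (h : k ≤ l) (w : Pref n k)
    (f : Fin (n l) → Fin (n l)) (y : Pref n (l + 1)) : Pref n (l + 1) := by
  classical
  exact if res n (h.trans (Nat.le_succ l)) y = w then
    Function.update y (Fin.last l) (f (y (Fin.last l))) else y

theorem res_digitFun (n : ℕ → ℕ) {k l : ℕ} (h : k ≤ l) (w : Pref n k)
    (f : Fin (n l) → Fin (n l)) (y : Pref n (l + 1)) :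
    res n (h.trans (Nat.le_succ l)) (digitFun n h w f y) = res n (h.trans (Nat.le_succ l)) y := by
  unfold digitFun
  split_ifs
  · funext i
    have : (Fin.castLE (h.trans (Nat.le_succ l)) i) ≠ Fin.last l := by
      intro hi
      have := congrArg Fin.val hi
      have hi' := i.2
      simp at this
      omega
    simp only [res]
    rw [Function.update_of_ne this]
  · rfl

theorem digitFun_digitFun (n : ℕ → ℕ) {k l : ℕ} (h : k ≤ l) (w : Pref n k)
    {f f' : Fin (n l) → Fin (n l)} (hf : ∀ a, f (f' a) = a) (y : Pref n (l + 1)) :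
    digitFun n h w f (digitFun n h w f' y) = y := by
  have hr := res_digitFun n h w f' y
  rw [digitFun, hr]
  unfold digitFun
  split_ifs
  · simp [hf]
  · rfl

/-- Add one, without carry, to the digit `l` of those sequences whose first `k` digits are `w`. -/
noncomputable def digitPerm (n : ℕ → ℕ) [∀ k, (n k).AtLeastTwo] {k l : ℕ} (h : k ≤ l)
    (w : Pref n k) : SymLim n :=
  toLim n (l + 1)
    { toFun := digitFun n h w (· + 1)
      invFun := digitFun n h w (· - 1)
      left_inv := digitFun_digitFun n h w fun _ => sub_eq_of_eq_add rfl
      right_inv := digitFun_digitFun n h w fun a => sub_add_cancel a 1 }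

theorem act_digitPerm_of_ne (n : ℕ → ℕ) [∀ k, (n k).AtLeastTwo] {k l : ℕ} (h : k ≤ l)
    (w : Pref n k) (x : X n) (hx : pre n k x ≠ w) : act n (digitPerm n h w) x = x := by
  have hx' : res n (h.trans (Nat.le_succ l)) (pre n (l + 1) x) ≠ w := hx
  rw [digitPerm, act_toLim]
  funext i
  by_cases hi : i < l + 1
  · simp [actFun, hi, digitFun, hx', pre]
  · simp [actFun, hi]

theorem act_digitPerm_of_eq (n : ℕ → ℕ) [∀ k, (n k).AtLeastTwo] {k l : ℕ} (h : k ≤ l)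
    (w : Pref n k) (x : X n) (hx : pre n k x = w) :
    act n (digitPerm n h w) x = Function.update x l (x l + 1) := by
  have hx' : res n (h.trans (Nat.le_succ l)) (pre n (l + 1) x) = w := hx
  rw [digitPerm, act_toLim]
  funext i
  by_cases hi : i < l + 1
  · rcases Nat.lt_succ_iff_lt_or_eq.1 hi with h1 | rfl
    · have h2 : (⟨i, hi⟩ : Fin (l + 1)) ≠ Fin.last l := fun h3 =>
        h1.ne (congrArg Fin.val h3)
      simp [actFun, hi, digitFun, hx', Function.update_of_ne h2, h1.ne, pre]
    · rw [Function.update_self]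
      simp only [actFun, hi, dif_pos, Equiv.coe_fn_mk, digitFun, hx', if_pos]
      exact Function.update_self _ _ _
  · rw [Function.update_of_ne (by omega)]
    simp [actFun, hi]

theorem act_digitPerm_ne_self (n : ℕ → ℕ) [∀ k, (n k).AtLeastTwo] {k l : ℕ} (h : k ≤ l)
    (w : Pref n k) (x : X n) (hx : pre n k x = w) : act n (digitPerm n h w) x l ≠ x l := by
  rw [act_digitPerm_of_eq n h w x hx, Function.update_self, Ne, add_eq_left]
  have h2 : 2 ≤ n l := Nat.AtLeastTwo.prop
  rw [Fin.ext_iff, Fin.val_one', Nat.mod_eq_of_lt (by omega : 1 < n l), Fin.val_zero]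
  exact one_ne_zero

/-- The first `l` digits are unchanged, so the displacement is a multiple of `N_l`; it is nonzero
because digit `l` changes, and `N_l > l`. -/
theorem lt_abs_d_digitPerm (n : ℕ → ℕ) [∀ k, (n k).AtLeastTwo] {k l : ℕ} (h : k ≤ l)
    (w : Pref n k) (x : X n) (hx : pre n k x = w) : (l : ℤ) < |d n (digitPerm n h w) x| := by
  set m := d n (digitPerm n h w) x with hm
  have h0 : m ≠ 0 := fun h1 =>
    act_digitPerm_ne_self n h w x hx (congrFun ((d_eq_zero_iff n _ x).1 h1) l)
  have h1 := val_odo_zpow n l x m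
  rw [hm, ← d_spec, ← hm, (pre_eq_iff_val_eq n l (act n (digitPerm n h w) x) x).1] at h1
  · have h2 : (N n l : ℤ) ∣ m := by
      have := h1.dvd
      rwa [add_sub_cancel_left] at this
    have h3 : (N n l : ℤ) ≤ |m| := Int.le_of_dvd (abs_pos.2 h0) ((dvd_abs _ _).2 h2)
    have h4 : (l : ℤ) < N n l := by exact_mod_cast lt_N n l
    omega
  · rw [act_digitPerm_of_eq n h w x hx]
    funext i
    exact Function.update_of_ne i.2.ne _ _

/-! ### Infinite dimension -/

/-- The prefix `w` is empty, so digit `l` is changed at every point. Two such elements with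
different `l` agree nowhere, and the inner product is the measure of the set where they agree. -/
theorem orthonormal_F_digitPerm (n : ℕ → ℕ) [∀ k, (n k).AtLeastTwo] (w : Pref n 0) :
    Orthonormal ℂ fun l : ℕ =>
      (F n (digitPerm n (Nat.zero_le l) w) : HSp n →L[ℂ] HSp n) (xi0 n) := by
  refine ⟨fun l => ?_, fun l l' hl => ?_⟩
  · rw [← norm_xi0 n]
    exact (FIso n _).norm_map _
  · have h1 : inner ℂ ((F n (digitPerm n (Nat.zero_le l) w) : HSp n →L[ℂ] HSp n) (xi0 n))
        ((F n (digitPerm n (Nat.zero_le l') w) : HSp n →L[ℂ] HSp n) (xi0 n)) =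
        inner ℂ (xi0 n) ((F n ((digitPerm n (Nat.zero_le l) w)⁻¹ *
          digitPerm n (Nat.zero_le l') w) : HSp n →L[ℂ] HSp n) (xi0 n)) := by
      rw [← ContinuousLinearMap.adjoint_inner_right, map_mul, map_inv]
      rfl
    refine h1.trans ?_
    rw [inner_xi0_F]
    have h2 : {x | act n ((digitPerm n (Nat.zero_le l) w)⁻¹ * digitPerm n (Nat.zero_le l') w) x
        = x} = ∅ := by
      refine Set.eq_empty_of_forall_notMem fun x hx => ?_
      rw [Set.mem_ofPred_eq, map_mul, map_inv, Equiv.Perm.mul_apply,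
        Equiv.Perm.inv_eq_iff_eq] at hx
      have hw : pre n 0 x = w := funext fun i => i.elim0
      refine act_digitPerm_ne_self n (Nat.zero_le l) w x hw ?_
      rw [← hx, act_digitPerm_of_eq n (Nat.zero_le l') w x hw, Function.update_of_ne hl]
    rw [h2]
    simp

theorem not_finiteDimensional_generatedVN (n : ℕ → ℕ) [∀ k, (n k).AtLeastTwo] :
    ¬ FiniteDimensional ℂ (generatedVN (F n)).toStarSubalgebra := by
  intro hfin
  let w : Pref n 0 := fun i => i.elim0
  let u : ℕ → (generatedVN (F n)).toStarSubalgebra := fun l =>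
    ⟨F n (digitPerm n (Nat.zero_le l) w), apply_mem_generatedVN (F n) _⟩
  let ev : (generatedVN (F n)).toStarSubalgebra →ₗ[ℂ] HSp n :=
    { toFun := fun a => (a : HSp n →L[ℂ] HSp n) (xi0 n)
      map_add' := fun a b => rfl
      map_smul' := fun c a => rfl }
  have h : LinearIndependent ℂ u :=
    LinearIndependent.of_comp ev (orthonormal_F_digitPerm n w).linearIndependent
  exact not_finite_iff_infinite.2 inferInstance h.finite

/-! ### The center -/

/-- The action of `g` on the second point of a pair in the orbit relation. -/
noncomputable def coskew (n : ℕ → ℕ) [∀ k, (n k).AtLeastTwo] (g : SymLim n) (z : X n × ℤ) :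
    X n × ℤ := (z.1, z.2 + d n g ((odometer n ^ z.2) z.1))

/-- Acting on the second point is the conjugate by the exchange of acting on the first; measure
preservation is inherited from this. -/
theorem coskew_eq (n : ℕ → ℕ) [∀ k, (n k).AtLeastTwo] (g : SymLim n) :
    coskew n g = flip n ∘ skew n g ∘ flip n := by
  funext z
  refine Prod.ext ?_ ?_
  · change z.1 = (odometer n ^ (skew n g (flip n z)).2) (skew n g (flip n z)).1
    rw [orbit_skew]
    exact (congrArg Prod.fst (flip_flip n z)).symm
  · simp only [coskew, flip, skew, Function.comp_apply]
    ring

theorem measurePreserving_coskew (n : ℕ → ℕ) [∀ k, (n k).AtLeastTwo] (g : SymLim n) :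
    MeasurePreserving (coskew n g) (mu n) (mu n) := by
  rw [coskew_eq]
  exact (measurePreserving_flip n).comp
    ((measurePreserving_skew n g).comp (measurePreserving_flip n))

theorem coskew_comm (n : ℕ → ℕ) [∀ k, (n k).AtLeastTwo] (g h : SymLim n) :
    coskew n g ∘ skew n h = skew n h ∘ coskew n g := by
  funext z
  refine Prod.ext rfl ?_
  simp only [Function.comp_apply, coskew, orbit_skew]
  simp only [skew]
  ring

/-- The diagonal action of `g` on the pairs in the orbit relation. -/
noncomputable def diag (n : ℕ → ℕ) [∀ k, (n k).AtLeastTwo] (g : SymLim n) (z : X n × ℤ) :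
    X n × ℤ := coskew n g (skew n g z)

theorem measurePreserving_diag (n : ℕ → ℕ) [∀ k, (n k).AtLeastTwo] (g : SymLim n) :
    MeasurePreserving (diag n g) (mu n) (mu n) :=
  (measurePreserving_coskew n g).comp (measurePreserving_skew n g)

theorem diag_fst (n : ℕ → ℕ) [∀ k, (n k).AtLeastTwo] (g : SymLim n) (z : X n × ℤ) :
    (diag n g z).1 = act n g z.1 := rfl

theorem diag_snd (n : ℕ → ℕ) [∀ k, (n k).AtLeastTwo] (g : SymLim n) (z : X n × ℤ) :
    (diag n g z).2 = z.2 - d n g z.1 + d n g ((odometer n ^ z.2) z.1) := by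
  simp only [diag, coskew, orbit_skew]
  rfl

/-- Since `g` is injective, `g x = g y` only when `x = y`, and by freeness `x = y` means `m = 0`. -/
theorem diag_snd_eq_zero_iff (n : ℕ → ℕ) [∀ k, (n k).AtLeastTwo] (g : SymLim n) (z : X n × ℤ) :
    (diag n g z).2 = 0 ↔ z.2 = 0 := by
  rw [diag_snd]
  refine ⟨fun h => ?_, fun h => by rw [h]; simp⟩
  have h1 : act n g ((odometer n ^ z.2) z.1) = act n g z.1 := by
    rw [d_spec, d_spec n g z.1, ← Equiv.Perm.mul_apply, ← zpow_add]
    congr 2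
    omega
  have h2 : (odometer n ^ z.2) z.1 = (odometer n ^ (0 : ℤ)) z.1 := by
    simpa using (act n g).injective h1
  exact odo_zpow_injective n z.1 h2

/-- The diagonal action is the action on the first point followed by that on the second. A central
`a` commutes with the former as an element of the commutant and with the latter as an element of the
algebra, while `xi0` is fixed because the diagonal is. -/
theorem compOp_diag_apply_xi0 (n : ℕ → ℕ) [∀ k, (n k).AtLeastTwo] {a : HSp n →L[ℂ] HSp n}
    (ha : a ∈ generatedVN (F n)) (ha' : a ∈ (generatedVN (F n)).commutant) (g : SymLim n) :
    compOp (diag n g) (measurePreserving_diag n g) (a (xi0 n)) = a (xi0 n) := by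
  have h1 : ∀ η, compOp (skew n g) (measurePreserving_skew n g) (a η) =
      a (compOp (skew n g) (measurePreserving_skew n g) η) := fun η => by
    have h2 := VonNeumannAlgebra.mem_commutant_iff.1 ha' _ (apply_mem_generatedVN (F n) g⁻¹)
    have h3 := F_eq_compOp n g⁻¹
    simp only [inv_inv] at h3
    rw [h3] at h2
    exact DFunLike.congr_fun h2 η
  have hd : coskew n g ∘ skew n g = diag n g := rfl
  rw [← compOp_compOp (measurePreserving_skew n g) (measurePreserving_coskew n g) _ hd,
    compOp_comm n ha _ _ (coskew_comm n g), h1,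
    compOp_compOp _ _ (measurePreserving_diag n g) hd, xi0_eq_box, box, compOp_indicatorConstLp]
  ext z
  simp [diag_snd_eq_zero_iff]

/-! ### Diagonally invariant vectors off the diagonal. -/

theorem setLIntegral_diag_preimage (n : ℕ → ℕ) [∀ k, (n k).AtLeastTwo] {v : HSp n}
    (hv : ∀ g, compOp (diag n g) (measurePreserving_diag n g) v = v)
    (g : SymLim n) {s : Set (X n × ℤ)} (hs : MeasurableSet s) :
    ∫⁻ z in diag n g ⁻¹' s, ‖v z‖ₑ ^ 2 ∂mu n = ∫⁻ z in s, ‖v z‖ₑ ^ 2 ∂mu n := by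
  have hm : Measurable fun z => ‖v z‖ₑ ^ 2 := (Lp.stronglyMeasurable v).enorm.pow_const 2
  rw [← (measurePreserving_diag n g).setLIntegral_comp_preimage hs hm]
  refine lintegral_congr_ae (ae_restrict_of_ae ?_)
  have h := coeFn_compOp (diag n g) (measurePreserving_diag n g) v
  rw [hv g] at h
  filter_upwards [h] with z hz
  rw [hz]
  rfl

/-- The choice `k = |m|` gives `N_k > |m|`, so `x` and `O ^ m x` have different `k`-prefixes. A
digit change at place `l ≥ k` on the cylinder of `w` therefore moves `x` and fixes `O ^ m x`, which
sends the pair to one at distance more than `l - k`. By invariance the mass of the cylinder is at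
most the mass of such distant pairs, which tends to `0`. -/
theorem setLIntegral_cylinder_eq_zero (n : ℕ → ℕ) [∀ k, (n k).AtLeastTwo] {v : HSp n}
    (hv : ∀ g, compOp (diag n g) (measurePreserving_diag n g) v = v)
    {m : ℤ} (hm : m ≠ 0) {k : ℕ} (hk : k = m.natAbs)
    (w : Pref n k) :
    ∫⁻ z in (pre n k ⁻¹' {w}) ×ˢ {m}, ‖v z‖ₑ ^ 2 ∂mu n = 0 := by
  let ρ : Measure (X n × ℤ) := (mu n).withDensity fun z => ‖v z‖ₑ ^ 2
  have hρ : ∀ s, MeasurableSet s → ρ s = ∫⁻ z in s, ‖v z‖ₑ ^ 2 ∂mu n := fun s hs =>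
    withDensity_apply _ hs
  have hfin : IsFiniteMeasure ρ := by
    refine isFiniteMeasure_withDensity ?_
    have := lintegral_rpow_enorm_lt_top_of_eLpNorm_lt_top (by norm_num) (by norm_num)
      (Lp.eLpNorm_lt_top v)
    simpa using this.ne
  -- Pairs at distance more than `l - k`, with `k` moved to the right; these sets decrease to the
  -- empty set.
  let B : ℕ → Set (X n × ℤ) := fun l => {z | (l : ℤ) < |z.2| + k}
  have hB : ∀ l, MeasurableSet (B l) := fun l =>
    measurable_snd (MeasurableSet.of_discrete (s := {j : ℤ | (l : ℤ) < |j| + k}))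
  have hlim : Filter.Tendsto (fun l => ρ (B l)) Filter.atTop (nhds 0) := by
    have h := tendsto_measure_iInter_atTop (μ := ρ) (fun l => (hB l).nullMeasurableSet)
      (fun i j hij z (hz : (j : ℤ) < |z.2| + k) =>
        show (i : ℤ) < |z.2| + k from lt_of_le_of_lt (by exact_mod_cast hij) hz)
      ⟨0, measure_ne_top ρ _⟩
    have he : ⋂ l, B l = ∅ := by
      refine Set.eq_empty_of_forall_notMem fun z hz => ?_
      have := Set.mem_iInter.1 hz (|z.2| + k).toNat
      simp only [B, Set.mem_ofPred_eq] at this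
      omega
    rwa [he, measure_empty] at h
  have hA : MeasurableSet ((pre n k ⁻¹' {w}) ×ˢ {m} : Set (X n × ℤ)) :=
    (measurable_pre n k (measurableSet_singleton w)).prod (measurableSet_singleton m)
  rw [← hρ _ hA]
  refine le_antisymm (ge_of_tendsto hlim ?_) bot_le
  filter_upwards [Filter.eventually_ge_atTop k] with l hl
  rw [hρ _ (hB l), ← setLIntegral_diag_preimage n hv (digitPerm n hl w) (hB l),
    ← hρ _ ((measurePreserving_diag n _).measurable (hB l))]
  refine measure_mono ?_
  rintro ⟨x, j⟩ ⟨hx, hj⟩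
  have hx' : pre n k x = w := hx
  have hj' : j = m := hj
  subst hj'
  have h1 := lt_abs_d_digitPerm n hl w x hx'
  -- If the second point also had prefix `w`, then `N_k` would divide the nonzero `j`, although `|j|
  -- = k < N_k`.
  have h2 : d n (digitPerm n hl w) ((odometer n ^ j) x) = 0 := by
    rw [d_eq_zero_iff]
    refine act_digitPerm_of_ne n hl w _ fun h3 => ?_
    rw [← hx', pre_eq_iff_val_eq] at h3
    have h4 := val_odo_zpow n k x j
    rw [h3] at h4
    have h5 : (N n k : ℤ) ∣ j := by
      have := h4.dvd
      rwa [add_sub_cancel_left] at this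
    refine hm (Int.eq_zero_of_abs_lt_dvd h5 ?_)
    rw [Int.abs_eq_natAbs, ← hk]
    exact_mod_cast lt_N n k
  simp only [B, Set.mem_preimage, Set.mem_ofPred_eq, diag_snd, h2, add_zero]
  have h6 : (k : ℤ) = |j| := by rw [hk, Int.abs_eq_natAbs]
  have h7 := abs_sub_abs_le_abs_sub (d n (digitPerm n hl w) x) j
  have h8 := abs_sub_comm (d n (digitPerm n hl w) x) j
  omega

theorem inner_box_eq_zero_of_ne (n : ℕ → ℕ) [∀ k, (n k).AtLeastTwo] {v : HSp n}
    (hv : ∀ g, compOp (diag n g) (measurePreserving_diag n g) v = v)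
    (A : Set (X n)) (hA : MeasurableSet A) {m : ℤ} (hm : m ≠ 0) :
    inner ℂ (box n A hA m) v = 0 := by
  have h0 : ∫⁻ z in Set.univ ×ˢ {m}, ‖v z‖ₑ ^ 2 ∂mu n = 0 := by
    have hu : (Set.univ ×ˢ {m} : Set (X n × ℤ)) =
        ⋃ w : Pref n m.natAbs, (pre n m.natAbs ⁻¹' {w}) ×ˢ {m} := by
      ext z
      simp
    rw [hu]
    refine le_antisymm ((lintegral_iUnion_le _ _).trans ?_) bot_le
    simp [setLIntegral_cylinder_eq_zero n hv hm rfl]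
  have hm' : Measurable fun z => ‖v z‖ₑ ^ 2 := (Lp.stronglyMeasurable v).enorm.pow_const 2
  rw [lintegral_eq_zero_iff hm'] at h0
  rw [inner_box]
  refine integral_eq_zero_of_ae ?_
  filter_upwards [ae_restrict_of_ae_restrict_of_subset
    (Set.prod_mono (Set.subset_univ A) subset_rfl) h0] with z hz
  simpa using hz

/-! ### Diagonally invariant vectors on the diagonal. -/

theorem setIntegral_cylinder_eq (n : ℕ → ℕ) [∀ k, (n k).AtLeastTwo] {v : HSp n}
    (hv : ∀ g, compOp (diag n g) (measurePreserving_diag n g) v = v)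
    (k : ℕ) (w w' : Pref n k) :
    ∫ z in (pre n k ⁻¹' {w}) ×ˢ {(0 : ℤ)}, v z ∂mu n =
      ∫ z in (pre n k ⁻¹' {w'}) ×ˢ {(0 : ℤ)}, v z ∂mu n := by
  have hm : ∀ u : Pref n k, MeasurableSet (pre n k ⁻¹' {u}) := fun u =>
    measurable_pre n k (measurableSet_singleton u)
  classical
  -- The transposition of the two prefixes carries one cylinder to the other, and its diagonal
  -- action preserves both `v` and the diagonal.
  let g := toLim n k (Equiv.swap w w')
  rw [← inner_box n _ (hm w), ← inner_box n _ (hm w'),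
    ← inner_compOp (diag n g) (measurePreserving_diag n g), hv g]
  congr 1
  refine compOp_indicatorConstLp _ _ _ _ _ _ ?_ _
  ext z
  simp only [Set.mem_preimage, Set.mem_prod, Set.mem_singleton_iff, diag_snd_eq_zero_iff,
    diag_fst, g, act_toLim, pre_actFun]
  rw [Equiv.swap_apply_eq_iff, Equiv.swap_apply_left]

/-- The `N_k` cylinders of length `k` carry equal integrals with sum `⟨ξ₀, v⟩ = 0`, so each integral
vanishes; the π-λ theorem extends this to all measurable `A`. -/
theorem inner_box_zero_eq_zero (n : ℕ → ℕ) [∀ k, (n k).AtLeastTwo] {v : HSp n}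
    (hv : ∀ g, compOp (diag n g) (measurePreserving_diag n g) v = v)
    (h0 : inner ℂ (xi0 n) v = 0) (A : Set (X n))
    (hA : MeasurableSet A) : inner ℂ (box n A hA 0) v = 0 := by
  have hint : ∀ s : Set (X n), IntegrableOn v (s ×ˢ {(0 : ℤ)}) (mu n) := fun s => by
    have : IsFiniteMeasure ((mu n).restrict (s ×ˢ {(0 : ℤ)})) :=
      ⟨by simpa using (mu_box_ne_top n s 0).lt_top⟩
    exact ((Lp.memLp v).restrict _).integrable (by norm_num)
  have hu : ∫ z in Set.univ ×ˢ {(0 : ℤ)}, v z ∂mu n = 0 := by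
    rw [← inner_box n _ MeasurableSet.univ, ← xi0_eq_box, h0]
  rw [inner_box]
  have hsum : ∀ (k : ℕ) (B : Finset (Pref n k)),
      ∫ z in (pre n k ⁻¹' (B : Set (Pref n k))) ×ˢ {(0 : ℤ)}, v z ∂mu n =
        ∑ w ∈ B, ∫ z in (pre n k ⁻¹' {w}) ×ˢ {(0 : ℤ)}, v z ∂mu n := by
    intro k B
    have hB : ((pre n k ⁻¹' (B : Set (Pref n k))) ×ˢ {(0 : ℤ)} : Set (X n × ℤ)) =
        ⋃ w ∈ B, (pre n k ⁻¹' {w}) ×ˢ {(0 : ℤ)} := by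
      ext z
      simp
    rw [hB, integral_biUnion_finset]
    · exact fun w _ => (measurable_pre n k (measurableSet_singleton w)).prod
        (measurableSet_singleton _)
    · intro w _ w' _ hw
      exact Set.disjoint_left.2 fun z hz hz' => hw (hz.1.symm.trans hz'.1)
    · exact fun w _ => hint _
  have hcyl : ∀ (k : ℕ) (w : Pref n k),
      ∫ z in (pre n k ⁻¹' {w}) ×ˢ {(0 : ℤ)}, v z ∂mu n = 0 := by
    intro k w
    have h1 := hsum k Finset.univ
    rw [Finset.coe_univ, Set.preimage_univ, hu,
      Finset.sum_congr rfl fun w' _ => setIntegral_cylinder_eq n hv k w' w, Finset.sum_const,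
      eq_comm, smul_eq_zero] at h1
    exact h1.resolve_left (Finset.card_pos.2 ⟨w, Finset.mem_univ w⟩).ne'
  induction A, hA using MeasurableSpace.induction_on_inter
    generateFrom_measurableCylinders.symm isPiSystem_measurableCylinders with
  | empty => simp
  | basic s hs =>
    obtain ⟨k, B, rfl⟩ := exists_cylinder_of_mem_measurableCylinders n hs
    have h1 := hsum k B.toFinite.toFinset
    rw [Set.Finite.coe_toFinset] at h1
    rw [h1]
    exact Finset.sum_eq_zero fun w _ => hcyl k w
  | compl s hs ih =>
    have h1 : (Set.univ ×ˢ {(0 : ℤ)} : Set (X n × ℤ)) = s ×ˢ {0} ∪ sᶜ ×ˢ {0} := by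
      rw [← Set.union_prod, Set.union_compl_self]
    rw [h1, setIntegral_union ?_ (hs.compl.prod (measurableSet_singleton _)) (hint _) (hint _), ih,
      zero_add] at hu
    · exact hu
    · exact Set.disjoint_left.2 fun z hz hz' => hz'.1 hz.1
  | iUnion f hd hf ih =>
    rw [Set.iUnion_prod_const, integral_iUnion (fun i => (hf i).prod (measurableSet_singleton _))]
    · simp [ih]
    · intro i j hij
      exact Set.disjoint_left.2 fun z hz hz' => Set.disjoint_left.1 (hd hij) hz.1 hz'.1
    · rw [← Set.iUnion_prod_const]
      exact hint _

theorem center_trivial_generatedVN (n : ℕ → ℕ) [∀ k, (n k).AtLeastTwo] (a : HSp n →L[ℂ] HSp n)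
    (ha : a ∈ generatedVN (F n)) (ha' : a ∈ (generatedVN (F n)).commutant) :
    ∃ c : ℂ, a = c • 1 := by
  -- The scalar can only be the trace of `a`; subtracting it makes the remaining central element
  -- orthogonal to `xi0` at `xi0`, as the diagonal case requires.
  set c : ℂ := inner ℂ (xi0 n) (a (xi0 n)) with hc
  have hone : ∀ M : VonNeumannAlgebra (HSp n), c • (1 : HSp n →L[ℂ] HSp n) ∈ M := fun M =>
    M.toStarSubalgebra.smul_mem (one_mem _) c
  have hb := sub_mem ha (hone _)
  have hb' := sub_mem ha' (hone _)
  have h0 : inner ℂ (xi0 n) ((a - c • (1 : HSp n →L[ℂ] HSp n)) (xi0 n)) = 0 := by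
    simp [inner_sub_right, inner_smul_right, norm_xi0, ← hc]
  have hv := compOp_diag_apply_xi0 n hb hb'
  refine ⟨c, sub_eq_zero.1 (eq_zero_of_apply_xi0 n hb (eq_zero_of_inner_box n _ fun A hA j => ?_))⟩
  by_cases hj : j = 0
  · subst hj
    exact inner_box_zero_eq_zero n hv h0 A hA
  · exact inner_box_eq_zero_of_ne n hv A hA hj

end OdometerRep

theorem mainTheorem5 (n : ℕ → ℕ) [∀ k, (n k).AtLeastTwo] :
    OdometerRep.IsII1Factor (OdometerRep.generatedVN (OdometerRep.F n)) ∧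
    OdometerRep.IsFaithfulNormalTrace (OdometerRep.generatedVN (OdometerRep.F n))
      (OdometerRep.vectorFunctional (OdometerRep.generatedVN (OdometerRep.F n))
        (OdometerRep.xi0 n)) ∧
    ∀ g : OdometerRep.SymLim n,
      inner ℂ (OdometerRep.xi0 n)
        ((OdometerRep.F n g : OdometerRep.HSp n →L[ℂ] OdometerRep.HSp n) (OdometerRep.xi0 n)) =
        (OdometerRep.chiNat n g : ℂ) :=
  ⟨⟨OdometerRep.center_trivial_generatedVN n, OdometerRep.not_finiteDimensional_generatedVN n,
    ⟨_, OdometerRep.isFaithfulNormalTrace_vectorFunctional n⟩⟩,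
    OdometerRep.isFaithfulNormalTrace_vectorFunctional n,
    fun g => by rw [OdometerRep.inner_xi0_F, OdometerRep.nu_real_fixed]⟩
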